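/- **Conventions.** A *big tt-category* is a triangulated category $\mathcal T$ with small coproducts and a symmetric monoidal structure whose tensor product is exact and preserves coproducts in each variable, such that the compact objects (those $x$ for which $\mathrm{Hom}(x,-)\colon\mathcal T\to\mathrm{Ab}$ commutes with small coproducts) coincide with the rigid ones (those admitting a $\otimes$-dual), form an essentially small subcategory $\mathcal T^c$, and generate $\mathcal T$ as a localizing subcategory. A *tt-field* is a big tt-category $\mathcal F$ in which every object is a coproduct of compact objects and $X\otimes-$ is faithful for every nonzero $X$. Let $\mathrm{Mod}\text{-}\mathcal T^c$ be the category of additive functors $(\mathcal T^c)^{\mathrm{op}}\to\mathrm{Ab}$, and $h\colon\mathcal T\to\mathrm{Mod}\text{-}\mathcal T^c$, $h(X)=\mathrm{Hom}_{\mathcal T}(-,X)|_{\mathcal T^c}$, the restricted Yoneda functor; similarly for $\mathcal F$. **Theorem 4.2.** Let $\mathcal T$ be a big tt-category, $\mathcal F$ a tt-field and $F\colon\mathcal T\to\mathcal F$ a (strong, not necessarily symmetric) monoidal exact functor with a right adjoint $U$. There is a cocontinuous functor $\hat F\colon\mathrm{Mod}\text{-}\mathcal T^c\to\mathrm{Mod}\text{-}\mathcal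 F^c$ with $\hat F\,h\cong h\,F$; any such $\hat F$ is exact, and $\mathrm{Ker}(\hat F)=\mathrm{Loc}(\mathcal B)$, the smallest Serre subcategory closed under coproducts containing the class $\mathcal B$ of finitely presented objects of $\mathrm{Ker}(\hat F)$. Let $Q\colon\mathrm{Mod}\text{-}\mathcal T^c\to\mathcal A_{\mathcal B}:=(\mathrm{Mod}\text{-}\mathcal T^c)/\mathrm{Ker}(\hat F)$ be the Gabriel quotient (the homological residue field attached to $F$), an abelian category. Then $\hat F$ factors as $\hat F\cong\bar F\,Q$, and for every such factorization the functor $\bar F\colon\mathcal A_{\mathcal B}\to\mathrm{Mod}\text{-}\mathcal F^c$ is exact, faithful and comonadic: it has a right adjoint, and for every adjunction $\bar F\dashv\bar U$ the comparison functor from $\mathcal A_{\mathcal B}$ to the Eilenberg–Moore category of comodules for the comonad $\bar F\bar U$ on $\mathrm{Mod}\text{-}\mathcal F^c$ is an equivalence. Moreover $\bar F\bar U\cong\widehat{FU}$. Here a comonad $H$ on $\mathrm{Mod}\text{-}\mathcal F^c$ is said to be a comonad $\widehat{FU}$ induced by the comonad $FU$ on $\mathcal F$ if it is cocontinuous and there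 is a natural isomorphism $H\,h\cong h\,FU$ compatible with counits and comultiplications. Then $\bar F\bar U$ is such a comonad, every such comonad $H$ is isomorphic to $\bar F\bar U$ as a comonad, and there is an equivalence of $\mathcal A_{\mathcal B}$ with the Eilenberg–Moore category of $H$-comodules under which the forgetful functor to $\mathrm{Mod}\text{-}\mathcal F^c$ corresponds to $\bar F$. -/

import Mathlib

open CategoryTheory Category Limits MonoidalCategory

universe v u u₁ u₂

namespace HomologicalResidue

noncomputable section

section AdditiveFunctors

variable {C : Type*} {D : Type*} [Category* C] [Category* D] [Preadditive C] [Abelian D]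

/-! Additive functors are closed under subobjects, quotients and finite products in the abelian
category of all functors; hence they form an abelian category. -/

instance : (additiveFunctor C D).IsClosedUnderSubobjects where
  prop_of_mono {F G} i _ hG := by
    have : G.Additive := hG
    refine (additiveFunctor_iff F).2 ⟨fun {X Y f g} => ?_⟩
    rw [← cancel_mono (i.app Y)]
    simp [Preadditive.add_comp, Preadditive.comp_add]

instance : (additiveFunctor C D).IsClosedUnderQuotients where
  prop_of_epi {F G} p _ hF := by
    have : F.Additive := hF
    refine (additiveFunctor_iff G).2 ⟨fun {X Y f g} => ?_⟩
    rw [← cancel_epi (p.app X)]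
    simp only [← p.naturality, Preadditive.comp_add, F.map_add, Preadditive.add_comp]

instance : (additiveFunctor C D).ContainsZero where
  exists_zero := ⟨_, isZero_zero (C ⥤ D),
    (additiveFunctor_iff _).2 (Functor.Additive.of_isZero (isZero_zero _))⟩

instance : (additiveFunctor C D).IsClosedUnderFiniteProducts := by
  refine ObjectProperty.IsClosedUnderFiniteProducts.of_isClosedUnderLimitsOfShape.{0}
    (fun n _ => ⟨fun F ⟨⟨K, π, hK⟩, hF⟩ => ?_⟩)
  refine (additiveFunctor_iff F).2 ⟨fun {X Y f g} => ?_⟩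
  refine (isLimitOfPreserves ((evaluation C D).obj Y) hK).hom_ext fun j => ?_
  have : (K.obj j).Additive := hF j
  simp [Preadditive.add_comp, Preadditive.comp_add]

end AdditiveFunctors

section Triangulated

variable (T : Type u) [Category.{v} T] [Preadditive T]

/-- An object `x` is compact if `Hom(x, -)`, as a functor to abelian groups, commutes with small
coproducts. -/
def isCompact : ObjectProperty T := fun x =>
  ∀ ι : Type v, PreservesColimitsOfShape (Discrete ι) (preadditiveCoyoneda.obj (Opposite.op x))

/-- An object of a (symmetric) monoidal category is rigid if it admits a dual. -/
def isRigid {T : Type u} [Category.{v} T] [MonoidalCategory T] : ObjectProperty T := fun x =>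
  ∃ y : T, Nonempty (ExactPairing x y)

/-- The full subcategory `T^c` of compact objects. -/
abbrev Compacts := (isCompact T).FullSubcategory

/-- The category `Mod-T^c` of additive functors `(T^c)ᵒᵖ ⥤ Ab`. -/
abbrev ModCompacts := (Compacts T)ᵒᵖ ⥤+ AddCommGrpCat.{v}

/-- The restricted Yoneda functor `T ⥤ Mod-T^c`, `X ↦ Hom(-, X)` restricted to `T^c`. -/
def restrictedYoneda : T ⥤ ModCompacts T :=
  (additiveFunctor _ _).lift
    (preadditiveYoneda ⋙ (Functor.whiskeringLeft _ _ _).obj (isCompact T).ι.op)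
    (fun X => (additiveFunctor_iff _).2
      (inferInstanceAs (((isCompact T).ι.op ⋙ preadditiveYoneda.obj X).Additive)))

variable [HasZeroObject T] [HasShift T ℤ] [∀ n : ℤ, (shiftFunctor T n).Additive]
  [Pretriangulated T] [MonoidalCategory T] [SymmetricCategory T]

/-- A triangulated category with a symmetric monoidal structure is a big tt-category if it has
small coproducts, its tensor product is exact and preserves small coproducts in each variable (by
symmetry one variable is enough), its compact objects coincide with its rigid objects, these form
an essentially small subcategory, and they generate it as a localizing subcategory. -/
structure IsBigTTCategory : Prop where
  hasCoproducts : HasCoproducts.{v} T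
  tensor_exact : ∀ X : T, ∃ _ : (tensorLeft X).CommShift ℤ, (tensorLeft X).IsTriangulated
  tensor_coproducts : ∀ (X : T) (ι : Type v),
    PreservesColimitsOfShape (Discrete ι) (tensorLeft X)
  compact_iff_rigid : ∀ X : T, isCompact T X ↔ isRigid X
  essentiallySmall : EssentiallySmall.{v} (Compacts T)
  generates : ∀ P : ObjectProperty T, P.IsTriangulated →
    (∀ ι : Type v, P.IsClosedUnderColimitsOfShape (Discrete ι)) → isCompact T ≤ P → ∀ X, P X

/-- A tt-field is a big tt-category in which every object is a coproduct of compact objects and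
tensoring with any nonzero object is a faithful functor. -/
structure IsTTField : Prop extends IsBigTTCategory T where
  coproduct_of_compacts : ∀ X : T, ∃ (ι : Type v) (x : ι → T) (c : Cofan x),
    (∀ i, isCompact T (x i)) ∧ Nonempty (IsColimit c) ∧ Nonempty (c.pt ≅ X)
  tensor_faithful : ∀ X : T, ¬ IsZero X → (tensorLeft X).Faithful

end Triangulated

section Abelian

variable {A : Type*} [Category* A] [Abelian A]

/-- The morphisms whose kernel and cokernel belong to `P`. -/
def isoMod (P : ObjectProperty A) : MorphismProperty A :=
  fun _ _ f => P (kernel f) ∧ P (cokernel f)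

/-- The Gabriel quotient `A / P`: the localization of `A` at the morphisms whose kernel and
cokernel belong to `P`. -/
abbrev GabrielQuotient (P : ObjectProperty A) := (isoMod P).Localization

/-- The quotient functor `A ⥤ A / P`. -/
abbrev gabrielQ (P : ObjectProperty A) : A ⥤ GabrielQuotient P := (isoMod P).Q

/-- `Loc(B)`: the smallest class of objects containing `B` which is a Serre subcategory
and is closed under (`v`-small) coproducts. -/
def loc (B : ObjectProperty A) : ObjectProperty A := fun M =>
  ∀ P : ObjectProperty A, P.IsSerreClass →
    (∀ ι : Type v, P.IsClosedUnderColimitsOfShape (Discrete ι)) → B ≤ P → P M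

end Abelian

/-- An extension of a comonad `G` on `C` to a comonad `H` on `D`, along a functor `h : C ⥤ D`:
an isomorphism `H h ≅ h G` compatible with the counits and the comultiplications. -/
structure ComonadExtension {C : Type*} {D : Type*} [Category* C] [Category* D]
    (h : C ⥤ D) (G : Comonad C) (H : Comonad D) where
  /-- the comparison isomorphism -/
  iso : h ⋙ H.toFunctor ≅ G.toFunctor ⋙ h
  counit : ∀ X : C, iso.hom.app X ≫ h.map (G.ε.app X) = H.ε.app (h.obj X)
  comul : ∀ X : C, iso.hom.app X ≫ h.map (G.δ.app X) =
    H.δ.app (h.obj X) ≫ H.toFunctor.map (iso.hom.app X) ≫ iso.hom.app (G.toFunctor.obj X)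

section Diagram

variable {T : Type u₁} [Category.{v} T] [Preadditive T]
  {K : Type u₂} [Category.{v} K] [Preadditive K]

/-- A comonad `H` on `Mod-K^c` is induced by a comonad `G` on `K` (that is, `H` is `Ĝ`) if it is
cocontinuous and extends `G` along the restricted Yoneda functor. -/
structure IsInducedComonad (G : Comonad K) (H : Comonad (ModCompacts K)) : Prop where
  cocontinuous : PreservesColimitsOfSize.{v, v} H.toFunctor
  extension : Nonempty (ComonadExtension (restrictedYoneda K) G H)

/-- The functors `F̂`, `F̄` attached to a functor `F : T ⥤ K`: `F̂ : Mod-T^c ⥤ Mod-K^c` is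
cocontinuous and extends `F` along the restricted Yoneda functors, and
`F̄ : (Mod-T^c)/Ker(F̂) ⥤ Mod-K^c` is the factorization of `F̂` through the Gabriel quotient. -/
structure MainDiagram (F : T ⥤ K) where
  /-- the functor `F̂` -/
  Fhat : ModCompacts T ⥤ ModCompacts K
  cocontinuous : PreservesColimitsOfSize.{v, v} Fhat
  /-- `F̂ h ≅ h F` -/
  yonedaIso : restrictedYoneda T ⋙ Fhat ≅ F ⋙ restrictedYoneda K
  /-- the functor `F̄` -/
  Fbar : GabrielQuotient Fhat.kernel ⥤ ModCompacts K
  /-- `F̄ Q ≅ F̂` -/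
  fac : gabrielQ Fhat.kernel ⋙ Fbar ≅ Fhat

/-- The category `A_B = (Mod-T^c) / Ker(F̂)`. -/
abbrev MainDiagram.AB {F : T ⥤ K} (d : MainDiagram F) := GabrielQuotient d.Fhat.kernel

/-- The class `B = Ker(F̂) ∩ mod-T^c` of finitely presented objects killed by `F̂`. -/
def MainDiagram.B {F : T ⥤ K} (d : MainDiagram F) : ObjectProperty (ModCompacts T) :=
  d.Fhat.kernel ⊓ ObjectProperty.isFinitelyPresentable.{v} (ModCompacts T)

end Diagram

end

end HomologicalResidue

/-!
Write `h` for the restricted Yoneda functors. The category `Mod-T^c` has enough projectives of the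
form `h X` with `X` a coproduct of compact objects, and on such `X` the functor `h` is fully
faithful (`isProjectiveGenerating_yonedaOnCoproducts`). Hence right exact functors out of `Mod-T^c`
and natural transformations between them are determined by, and can be constructed from, their
restriction to coproducts of compact objects (`IsProjectiveGenerating.exists_natIso`).

A functor `F` as in the theorem preserves coproducts, being a left adjoint, and compact objects,
since these are the rigid ones. So restriction along `F` is a functor `Mod-K^c ⥤ Mod-T^c`, whose
left adjoint `extension F` agrees with `F` on coproducts of compact objects. Every `F̂` is
isomorphic to this left adjoint. The heart of the matter is that the extension is exact. It suffices
to check exactness on `P₂ ⟶ P₁ ⟶ P₀` where `P₂` covers the fiber `W` of a morphism `P₁ ⟶ P₀` of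
coproducts of compact objects. In other words, maps from a compact object `c` to `F W` have to lift
to `F P₂` (`exists_lift_of_fiber`). Such a map comes from a finite part of the triangle
`W ⟶ P₁ ⟶ P₀`: up to a map factoring through `F (P₀⟦-1⟧)`, it factors through `F v`, where `v` is
the compact fiber of a map between finite subcoproducts of `P₁` and `P₀`. Once the extension is
exact, it agrees with `F` on all of `T`, as both `F̂ h` and `h F` are homological and preserve
coproducts.

Let `F̂ M = 0` and let `x ⟶ M` be an element of `M`, with `x` compact. It comes from a map
`x ⟶ P₀`, and for a presentation `P₁ ⟶ P₀` of `M` with cone `Z` the composite `x ⟶ P₀ ⟶ Z` is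
killed by `F`. Hence `F V ⟶ F x` has a section, where `V` is the fiber of `x ⟶ Z`, and by
compactness this section factors through `F y` for some compact `y` over `V`. The cokernel of
`h y ⟶ h x` is finitely presented, killed by `F̂`, and `x ⟶ M` factors through it
(`MainDiagram.exists_factorization_of_kernel`). So `Ker F̂` is generated by its finitely presented
objects.

An exact functor induces a faithful exact functor on the Gabriel quotient by its kernel, and
faithful exact left adjoints are comonadic (`comparison_isEquivalence`). The right adjoint of `F̄`
is restriction along `F` followed by `Q`; since `Hom(x, U Y) = Hom(F x, Y)` for compact `x`, the
square formed by `F`, `F̄`, `Q h` and `h` has an invertible mate, which says that the comonad of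
`F̄` extends `F U` (`comonadExtensionOfIsIsoMate`). All objects of `K` are coproducts of compact
objects, so a cocontinuous comonad on `Mod-K^c` is determined by its restriction along `h`
(`nonempty_comonadIso`).
-/

namespace HomologicalResidue

noncomputable section

/-! ### Comonads and adjunctions -/

section Comonadicity

variable {C : Type*} {D : Type*} [Category* C] [Category* D] {F : C ⥤ D} {G : D ⥤ C}

variable (adj : F ⊣ G)

/-- Morphisms of coalgebras between objects `F X` and `F Y` come from morphisms `X ⟶ Y`, since the
unit `Y ⟶ G F Y` equalizes its usual fork, this being so after applying `F`. -/
lemma exists_map_eq_of_coalgebraHom [HasEqualizers C]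
    [PreservesLimitsOfShape WalkingParallelPair F] [F.ReflectsIsomorphisms] {X Y : C}
    (g : F.obj X ⟶ F.obj Y)
    (hg : F.map (adj.unit.app X) ≫ F.map (G.map g) = g ≫ F.map (adj.unit.app Y)) :
    ∃ f : X ⟶ Y, F.map f = g := by
  have : ReflectsLimitsOfShape WalkingParallelPair F :=
    reflectsLimitsOfShape_of_reflectsIsomorphisms
  let hX : IsLimit (Fork.ofι (f := G.map (F.map (adj.unit.app Y)))
      (g := adj.unit.app (G.obj (F.obj Y))) (adj.unit.app Y) (adj.unit_naturality _)) :=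
    isLimitOfIsLimitForkMap F _ (Comonad.beckEqualizer ((Comonad.comparison adj).obj Y))
  have hg' : (adj.unit.app X ≫ G.map g) ≫ G.map (F.map (adj.unit.app Y)) =
      (adj.unit.app X ≫ G.map g) ≫ adj.unit.app (G.obj (F.obj Y)) := by
    have := congr(adj.unit.app X ≫ G.map $hg)
    simp only [Functor.map_comp, Functor.id_obj, Functor.comp_obj] at this
    rw [assoc, ← this]
    simp
  obtain ⟨f, hf⟩ := Fork.IsLimit.lift' hX (adj.unit.app X ≫ G.map g) hg'
  refine ⟨f, ?_⟩
  have h₁ : f ≫ adj.unit.app Y = adj.unit.app X ≫ G.map g := hf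
  have h₂ := congr(F.map $h₁ ≫ adj.counit.app (F.obj Y))
  simpa using h₂

/-- A coalgebra `a : A ⟶ F G A` is the value of `F` at the equalizer of `G a` and the unit of
`G A`. -/
lemma exists_comparison_obj_iso [HasEqualizers C]
    [PreservesLimitsOfShape WalkingParallelPair F] {A : D} (a : A ⟶ F.obj (G.obj A))
    (ha : a ≫ adj.counit.app A = 𝟙 A)
    (ha' : a ≫ F.map (adj.unit.app (G.obj A)) = a ≫ F.map (G.map a)) :
    ∃ (E : C) (e : F.obj E ≅ A), F.map (adj.unit.app E) ≫ F.map (G.map e.hom) = e.hom ≫ a := by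
  let i : equalizer (G.map a) (adj.unit.app (G.obj A)) ⟶ G.obj A :=
    equalizer.ι (G.map a) (adj.unit.app (G.obj A))
  have hi : i ≫ G.map a = i ≫ adj.unit.app (G.obj A) := equalizer.condition _ _
  have hE := isLimitForkMapOfIsLimit F _ (equalizerIsEqualizer (G.map a)
    (adj.unit.app (G.obj A)))
  obtain ⟨k, hk⟩ : ∃ k : A ⟶ F.obj (equalizer (G.map a) (adj.unit.app (G.obj A))),
      k ≫ F.map i = a := by
    obtain ⟨k, hk⟩ := Fork.IsLimit.lift' hE a ha'.symm
    exact ⟨k, hk⟩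
  have : Mono (F.map i) := mono_of_isLimit_fork hE
  have hi' : F.map i ≫ F.map (G.map a) = F.map i ≫ F.map (adj.unit.app (G.obj A)) := by
    rw [← F.map_comp, hi, F.map_comp]
  have hFi : (F.map i ≫ adj.counit.app A) ≫ a = F.map i := by
    have h := adj.counit.naturality a
    simp only [Functor.comp_map, Functor.id_map, Functor.comp_obj, Functor.id_obj] at h
    have h' := congr($hi' ≫ adj.counit.app (F.obj (G.obj A)))
    simp only [assoc, Functor.comp_obj, Functor.id_obj] at h'
    rw [h] at h'
    simpa using h'
  refine ⟨_, ⟨F.map i ≫ adj.counit.app A, k, ?_, ?_⟩, ?_⟩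
  · rw [← cancel_mono (F.map i), assoc, hk, hFi]
    exact (id_comp _).symm
  · exact ((assoc _ _ _).symm.trans congr($hk ≫ _)).trans ha
  · refine Eq.trans ?_ hFi.symm
    rw [← F.map_comp]
    simp

/-- The crude comonadicity theorem, for categories whose morphisms may live in different
universes: a faithful left adjoint that preserves equalizers and reflects isomorphisms is
comonadic. -/
lemma comparison_isEquivalence [HasEqualizers C]
    [PreservesLimitsOfShape WalkingParallelPair F] [F.Faithful] [F.ReflectsIsomorphisms] :
    (Comonad.comparison adj).IsEquivalence where
  faithful := ⟨fun {X Y f g} h => F.map_injective congr(($h).f)⟩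
  full := ⟨fun {X Y} g => by
    obtain ⟨f, hf⟩ := exists_map_eq_of_coalgebraHom adj g.f g.h
    exact ⟨f, Comonad.Coalgebra.Hom.ext hf⟩⟩
  essSurj := ⟨fun A => by
    obtain ⟨E, e, he⟩ := exists_comparison_obj_iso adj A.a A.counit A.coassoc
    exact ⟨E, ⟨Comonad.Coalgebra.isoMk e he⟩⟩⟩

end Comonadicity

section ComonadIso

variable {C : Type*} [Category* C]

/-- A morphism of comonads induces a functor between the categories of coalgebras. -/
def coalgebraFunctor {G H : Comonad C} (f : G ⟶ H) : G.Coalgebra ⥤ H.Coalgebra where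
  obj A :=
    { A := A.A
      a := A.a ≫ f.app A.A
      counit := by simp [A.counit]
      coassoc := by
        rw [assoc, f.app_δ, A.coassoc_assoc, H.map_comp, assoc, f.naturality_assoc] }
  map {A B} g :=
    { f := g.f
      h := by simp [← g.h_assoc] }

/-- Isomorphic comonads have equivalent categories of coalgebras. -/
def coalgebraEquivalence {G H : Comonad C} (e : G ≅ H) : G.Coalgebra ≌ H.Coalgebra where
  functor := coalgebraFunctor e.hom
  inverse := coalgebraFunctor e.inv
  unitIso := NatIso.ofComponents (fun A => Comonad.Coalgebra.isoMk (Iso.refl _) (by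
    have h : e.hom.app A.A ≫ e.inv.app A.A = 𝟙 (G.obj A.A) :=
      (ComonadIso.toNatIso e).hom_inv_id_app A.A
    have h' : A.a ≫ G.map (𝟙 A.A) = 𝟙 A.A ≫ (A.a ≫ e.hom.app A.A) ≫ e.inv.app A.A := by
      simp [h]
    exact h')) (fun f => Comonad.Coalgebra.Hom.ext ((comp_id _).trans (id_comp _).symm))
  counitIso := NatIso.ofComponents (fun A => Comonad.Coalgebra.isoMk (Iso.refl _) (by
    have h : e.inv.app A.A ≫ e.hom.app A.A = 𝟙 (H.obj A.A) :=
      (ComonadIso.toNatIso e).inv_hom_id_app A.A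
    have h' : ((A.a ≫ e.inv.app A.A) ≫ e.hom.app A.A) ≫ H.map (𝟙 A.A) = 𝟙 A.A ≫ A.a := by
      simp [h]
    exact h')) (fun f => Comonad.Coalgebra.Hom.ext ((comp_id _).trans (id_comp _).symm))
  functor_unitIso_comp A := Comonad.Coalgebra.Hom.ext (comp_id (𝟙 A.A))

end ComonadIso

section Mates

variable {C D C' D' : Type*} [Category* C] [Category* D] [Category* C'] [Category* D']
  {F : C ⥤ D} {U : D ⥤ C} (adj : F ⊣ U) {F' : C' ⥤ D'} {U' : D' ⥤ C'} (adj' : F' ⊣ U')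
  {L : C ⥤ C'} {R : D ⥤ D'} (θ : L ⋙ F' ≅ F ⋙ R)

/-- The components `L U Y ⟶ U' R Y` of the mate of a natural isomorphism `F' L ≅ R F`, for
adjunctions `F ⊣ U` and `F' ⊣ U'`. -/
def mate (Y : D) : L.obj (U.obj Y) ⟶ U'.obj (R.obj Y) :=
  adj'.homEquiv (L.obj (U.obj Y)) (R.obj Y)
    (θ.hom.app (U.obj Y) ≫ R.map (X := F.obj (U.obj Y)) (Y := Y) (adj.counit.app Y))

lemma mate_naturality {Y Z : D} (g : Y ⟶ Z) :
    L.map (U.map g) ≫ mate adj adj' θ Z = mate adj adj' θ Y ≫ U'.map (R.map g) := by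
  have h₁ := θ.hom.naturality (U.map g)
  have h₂ := congr(R.map $(adj.counit.naturality g))
  simp only [Functor.comp_map, Functor.map_comp, Functor.id_map, Functor.id_obj,
    Functor.comp_obj] at h₁ h₂ ⊢
  rw [mate, mate, ← adj'.homEquiv_naturality_left, ← adj'.homEquiv_naturality_right]
  congr 1
  rw [reassoc_of% h₁, h₂, assoc]

lemma map_mate_counit (Y : D) : F'.map (mate adj adj' θ Y) ≫ adj'.counit.app (R.obj Y) =
    θ.hom.app (U.obj Y) ≫ R.map (adj.counit.app Y) :=
  (adj'.homEquiv_counit _ _ _).symm.trans (Equiv.symm_apply_apply _ _)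

lemma map_unit_mate (X : C) : L.map (adj.unit.app X) ≫ mate adj adj' θ (F.obj X) =
    adj'.unit.app (L.obj X) ≫ U'.map (θ.hom.app X) := by
  have h : F'.map (L.map (adj.unit.app X)) ≫ θ.hom.app (U.obj (F.obj X)) =
    θ.hom.app X ≫ R.map (F.map (adj.unit.app X)) := θ.hom.naturality (adj.unit.app X)
  have h' : R.map (F.map (adj.unit.app X)) ≫ R.map (adj.counit.app (F.obj X)) =
      𝟙 (R.obj (F.obj X)) := by
    have := congr(R.map $(adj.left_triangle_components X))
    rwa [R.map_comp, R.map_id] at this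
  have h'' : F'.map (L.map (adj.unit.app X)) ≫ θ.hom.app (U.obj (F.obj X)) ≫
      R.map (adj.counit.app (F.obj X)) = θ.hom.app X := by
    rw [← assoc, h, assoc, h']
    exact comp_id _
  refine (adj'.homEquiv_naturality_left (L.map (adj.unit.app X)) _).symm.trans ?_
  exact (congrArg (adj'.homEquiv _ _) h'').trans (adj'.homEquiv_unit _ _ _)

lemma isIso_mate_of_isIso_mate {U'' : D' ⥤ C'} (adj'' : F' ⊣ U'') (Y : D)
    [h : IsIso (mate adj adj' θ Y)] : IsIso (mate adj adj'' θ Y) := by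
  have : mate adj adj'' θ Y =
      mate adj adj' θ Y ≫ (adj'.rightAdjointUniq adj'').hom.app (R.obj Y) := by
    have h : adj'.unit.app (L.obj (U.obj Y)) ≫ (adj'.rightAdjointUniq adj'').hom.app
      (F'.obj (L.obj (U.obj Y))) = adj''.unit.app (L.obj (U.obj Y)) :=
        Adjunction.unit_rightAdjointUniq_hom_app adj' adj'' _
    have h' := (adj'.rightAdjointUniq adj'').hom.naturality
      (θ.hom.app (U.obj Y) ≫ R.map (X := F.obj (U.obj Y)) (Y := Y) (adj.counit.app Y))
    simp only [mate, Adjunction.homEquiv_unit]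
    refine (congr($h.symm ≫ _)).trans ((assoc _ _ _).trans (Eq.trans ?_ (assoc _ _ _).symm))
    exact congr(_ ≫ $h'.symm)
  rw [this]
  infer_instance

/-- A commutative square of left adjoints whose mate is invertible exhibits the comonad of the
second adjunction as an extension of the comonad of the first. -/
def comonadExtensionOfIsIsoMate [∀ Y, IsIso (mate adj adj' θ Y)] :
    ComonadExtension R adj.toComonad adj'.toComonad :=
  have counit (X : D) : (F'.map (inv (mate adj adj' θ X)) ≫ θ.hom.app (U.obj X)) ≫
      R.map (adj.counit.app X) = adj'.counit.app (R.obj X) := by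
    have := map_mate_counit adj adj' θ X
    rw [assoc, ← this, ← F'.map_comp_assoc, IsIso.inv_hom_id, F'.map_id]
    exact id_comp _
  have comul (X : D) : (F'.map (inv (mate adj adj' θ X)) ≫ θ.hom.app (U.obj X)) ≫
      R.map (F.map (adj.unit.app (U.obj X))) = F'.map (adj'.unit.app (U'.obj (R.obj X))) ≫
      F'.map (U'.map (F'.map (inv (mate adj adj' θ X)) ≫ θ.hom.app (U.obj X))) ≫
      F'.map (inv (mate adj adj' θ (F.obj (U.obj X)))) ≫ θ.hom.app (U.obj (F.obj (U.obj X))) := by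
    have h₁ := map_unit_mate adj adj' θ (U.obj X)
    have h₂ : F'.map (L.map (adj.unit.app (U.obj X))) ≫ θ.hom.app (U.obj (F.obj (U.obj X))) =
      θ.hom.app (U.obj X) ≫ R.map (F.map (adj.unit.app (U.obj X))) :=
        θ.hom.naturality (adj.unit.app (U.obj X))
    have h₃ : inv (mate adj adj' θ X) ≫ adj'.unit.app (L.obj (U.obj X)) =
      adj'.unit.app (U'.obj (R.obj X)) ≫ U'.map (F'.map (inv (mate adj adj' θ X))) :=
        (adj'.unit_naturality (inv (mate adj adj' θ X))).symm
    have h₄ : L.map (adj.unit.app (U.obj X)) = adj'.unit.app (L.obj (U.obj X)) ≫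
        U'.map (θ.hom.app (U.obj X)) ≫ inv (mate adj adj' θ (F.obj (U.obj X))) := by
      rw [← assoc, IsIso.eq_comp_inv]
      exact h₁
    rw [assoc, ← h₂, h₄]
    simp only [Functor.map_comp, assoc]
    rw [← F'.map_comp_assoc, h₃, F'.map_comp, assoc]
  { iso := NatIso.ofComponents (fun X =>
      (F'.mapIso (asIso (mate adj adj' θ X))).symm ≪≫ θ.app (U.obj X)) (fun {X Y} g => by
        have h : F'.map (L.map (U.map g)) ≫ θ.hom.app (U.obj Y) =
          θ.hom.app (U.obj X) ≫ R.map (F.map (U.map g)) := θ.hom.naturality (U.map g)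
        have h' : U'.map (R.map g) ≫ inv (mate adj adj' θ Y) =
            inv (mate adj adj' θ X) ≫ L.map (U.map g) := by
          rw [IsIso.comp_inv_eq, assoc, IsIso.eq_inv_comp, mate_naturality]
        change F'.map (U'.map (R.map g)) ≫ F'.map (inv (mate adj adj' θ Y)) ≫ θ.hom.app (U.obj Y) =
          (F'.map (inv (mate adj adj' θ X)) ≫ θ.hom.app (U.obj X)) ≫ R.map (F.map (U.map g))
        rw [assoc, ← h, ← F'.map_comp_assoc, ← F'.map_comp_assoc, h'])
    counit := counit
    comul := comul }

end Mates

section Uniqueness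

variable {C : Type*} {D : Type*} [Category* C] [Category* D] {F : C ⥤ D} {U : D ⥤ C}

lemma exists_equivalence_coalgebra (adj : F ⊣ U) [(Comonad.comparison adj).IsEquivalence]
    {H : Comonad D} (i : adj.toComonad ≅ H) :
    ∃ E : C ≌ H.Coalgebra, Nonempty (E.functor ⋙ H.forget ≅ F) :=
  ⟨(Comonad.comparison adj).asEquivalence.trans (coalgebraEquivalence i), ⟨Iso.refl _⟩⟩

end Uniqueness

/-! ### Right exact functors determined on generating projectives -/

section RightExact

variable {A : Type*} [Category* A] [Abelian A] {E : Type*} [Category* E] [Abelian E]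

lemma additive_of_preservesFiniteColimits (G : A ⥤ E) [PreservesFiniteColimits G] : G.Additive := by
  have := preservesBinaryBiproducts_of_preservesBinaryCoproducts G
  exact Functor.additive_of_preservesBinaryBiproducts _

/-- A right exact functor preserves exact sequences `X ⟶ Y ⟶ Z ⟶ 0`. -/
lemma map_exact_of_epi (G : A ⥤ E) [PreservesFiniteColimits G] {X Y Z : A} {f : X ⟶ Y}
    {g : Y ⟶ Z} {w : f ≫ g = 0} (hS : (ShortComplex.mk f g w).Exact) (hg : Epi g) :
    ∃ w' : G.map f ≫ G.map g = 0, (ShortComplex.mk _ _ w').Exact := by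
  have := additive_of_preservesFiniteColimits G
  exact ⟨by rw [← G.map_comp, w, G.map_zero],
    (((Functor.preservesFiniteColimits_tfae G).out 3 1 :).1
      ‹PreservesFiniteColimits G› _ ⟨hS, hg⟩).1⟩

lemma preservesFiniteLimits_of_preservesMonomorphisms (G : A ⥤ E) [PreservesFiniteColimits G]
    [G.PreservesMonomorphisms] : PreservesFiniteLimits G := by
  have := additive_of_preservesFiniteColimits G
  rw [Functor.preservesFiniteLimits_iff_forall_exact_map_and_mono]
  intro S hS
  have := hS.mono_f
  exact ⟨(map_exact_of_epi G hS.exact hS.epi_g).2, inferInstance⟩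

end RightExact

section Extension

variable {P : Type*} [Category* P] {A : Type*} [Category* A] [Abelian A]
  {E : Type*} [Category* E] [Abelian E]

/-- A functor `h` into an abelian category is projectively generating if it is full, its values
are projective, and every object is a quotient of one of its values. -/
structure IsProjectiveGenerating (h : P ⥤ A) : Prop where
  full : h.Full
  projective : ∀ p, Projective (h.obj p)
  exists_epi : ∀ M : A, ∃ (p : P) (π : h.obj p ⟶ M), Epi π

variable {h : P ⥤ A} (hh : IsProjectiveGenerating h)

include hh

lemma IsProjectiveGenerating.exists_presentation (M : A) :
    ∃ (p q : P) (f : q ⟶ p) (π : h.obj p ⟶ M) (w : h.map f ≫ π = 0),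
      Epi π ∧ (ShortComplex.mk _ _ w).Exact := by
  obtain ⟨p, π, hπ⟩ := hh.exists_epi M
  obtain ⟨q, κ, hκ⟩ := hh.exists_epi (kernel π)
  have := hh.full
  refine ⟨p, q, h.preimage (κ ≫ kernel.ι π), π, by simp, hπ, ?_⟩
  rw [ShortComplex.exact_iff_epi_kernel_lift]
  have : kernel.lift π (h.map (h.preimage (κ ≫ kernel.ι π))) (by simp) = κ := by
    rw [← cancel_mono (kernel.ι π)]; simp
  dsimp
  rw [this]
  exact hκ

variable {G G' : A ⥤ E} [PreservesFiniteColimits G]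

omit [Abelian A] [Abelian E] in
lemma IsProjectiveGenerating.natTrans_ext {σ τ : G ⟶ G'}
    (hστ : ∀ p, σ.app (h.obj p) = τ.app (h.obj p)) : σ = τ := by
  ext M
  obtain ⟨p, π, hπ⟩ := hh.exists_epi M
  rw [← cancel_epi (G.map π), σ.naturality, τ.naturality, hστ]

/-- The key step in extending a natural transformation from `P`: the component at `M` is
characterized by its composite with all morphisms from objects in the image of `P`. -/
lemma IsProjectiveGenerating.exists_component [G'.PreservesZeroMorphisms] (σ : h ⋙ G ⟶ h ⋙ G') (M : A) :
    ∃ t : G.obj M ⟶ G'.obj M, ∀ (p : P) (π : h.obj p ⟶ M),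
      G.map π ≫ t = σ.app p ≫ G'.map π := by
  obtain ⟨p, q, f, π, w, hπ, hex⟩ := hh.exists_presentation M
  have := additive_of_preservesFiniteColimits G
  obtain ⟨w', hGex⟩ := map_exact_of_epi G hex hπ
  have : Epi (ShortComplex.mk _ _ w').g := inferInstanceAs (Epi (G.map π))
  have hσ {p q : P} (f : q ⟶ p) :
    G.map (h.map f) ≫ σ.app p = σ.app q ≫ G'.map (h.map f) := σ.naturality f
  obtain ⟨t, ht⟩ := hGex.desc' (σ.app p ≫ G'.map π)
    (by rw [← assoc, hσ, assoc, ← G'.map_comp, w, G'.map_zero, comp_zero])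
  refine ⟨t, fun p' π' => ?_⟩
  have := hh.projective p'
  have := hh.full
  obtain ⟨g, hg⟩ := h.map_surjective (Projective.factorThru π' π)
  have hg' : π' = h.map g ≫ π := by rw [hg, Projective.factorThru_comp]
  have ht' : G.map π ≫ t = σ.app p ≫ G'.map π := ht
  rw [hg', G.map_comp, assoc, ht', ← assoc, hσ, assoc, ← G'.map_comp]

/-- A natural transformation between right exact functors can be defined on a generating class
of projective objects. -/
lemma IsProjectiveGenerating.exists_natTrans [G'.PreservesZeroMorphisms] (σ : h ⋙ G ⟶ h ⋙ G') :
    ∃ τ : G ⟶ G', ∀ p, τ.app (h.obj p) = σ.app p := by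
  choose t ht using hh.exists_component σ
  refine ⟨{ app := t, naturality := fun M N g => ?_ }, fun p => ?_⟩
  · obtain ⟨p, π, hπ⟩ := hh.exists_epi M
    rw [← cancel_epi (G.map π), reassoc_of% ht M p π, ← G'.map_comp, ← ht, G.map_comp, assoc]
  · have := ht (h.obj p) p (𝟙 _)
    simpa using this

lemma IsProjectiveGenerating.exists_natIso [PreservesFiniteColimits G'] (σ : h ⋙ G ≅ h ⋙ G') :
    ∃ τ : G ≅ G', ∀ p, τ.hom.app (h.obj p) = σ.hom.app p := by
  have := additive_of_preservesFiniteColimits G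
  have := additive_of_preservesFiniteColimits G'
  obtain ⟨τ, hτ⟩ := hh.exists_natTrans σ.hom
  obtain ⟨τ', hτ'⟩ := hh.exists_natTrans σ.inv
  refine ⟨⟨τ, τ', hh.natTrans_ext fun p => ?_, hh.natTrans_ext fun p => ?_⟩, hτ⟩
  · simp [hτ, hτ']
  · simp [hτ, hτ']

/-- A right exact functor preserves monomorphisms as soon as it is exact on presentations
by generating projective objects. -/
lemma IsProjectiveGenerating.preservesFiniteLimits
    (H : ∀ {p₁ p₀ : P} (f : p₁ ⟶ p₀), ∃ (p₂ : P) (g : h.obj p₂ ⟶ h.obj p₁)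
      (w : g ≫ h.map f = 0) (w' : G.map g ≫ G.map (h.map f) = 0),
      (ShortComplex.mk _ _ w).Exact ∧ (ShortComplex.mk _ _ w').Exact) :
    PreservesFiniteLimits G := by
  have := additive_of_preservesFiniteColimits G
  -- subobjects of a projective `h p₀` are covered by the kernel-cover `p₂` of a map `p₁ ⟶ p₀`
  have mono_map {L : A} {p₀ : P} (j : L ⟶ h.obj p₀) [Mono j] : Mono (G.map j) := by
    obtain ⟨p₁, e, he⟩ := hh.exists_epi L
    have := hh.full
    obtain ⟨f, hf⟩ := h.map_surjective (e ≫ j)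
    obtain ⟨p₂, g, w, w', hex, hex'⟩ := H f
    rw [Preadditive.mono_iff_cancel_zero]
    intro Z z hz
    obtain ⟨Z', π, hπ, z', hz'⟩ := surjective_up_to_refinements_of_epi (G.map e) z
    have hz'' : z' ≫ G.map (h.map f) = 0 := by
      rw [hf, G.map_comp, ← reassoc_of% hz', hz, comp_zero]
    obtain ⟨Z'', π', hπ', y, hy⟩ := hex'.exact_up_to_refinements z' hz''
    have hge : g ≫ e = 0 := by rw [← cancel_mono j, assoc, ← hf, w, zero_comp]
    dsimp at hy
    rw [← cancel_epi π, ← cancel_epi π', hz', reassoc_of% hy, ← G.map_comp, hge]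
    simp
  -- a general monomorphism is pulled back along a projective cover of its target
  have : G.PreservesMonomorphisms := ⟨fun {M' M} i _ => by
    obtain ⟨p₀, π, hπ⟩ := hh.exists_epi M
    have hj := mono_map (pullback.snd i π)
    rw [Preadditive.mono_iff_cancel_zero]
    intro Z z hz
    obtain ⟨Z', ρ, hρ, l, hl⟩ := surjective_up_to_refinements_of_epi (G.map (pullback.fst i π)) z
    have hlπ : (l ≫ G.map (pullback.snd i π)) ≫ G.map π = 0 := by
      rw [assoc, ← G.map_comp, ← pullback.condition, G.map_comp, ← reassoc_of% hl, hz, comp_zero]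
    obtain ⟨_, hex⟩ := map_exact_of_epi G (ShortComplex.exact_kernel π) hπ
    obtain ⟨Z'', ρ', hρ', n, hn⟩ : ∃ (Z'' : E) (ρ' : Z'' ⟶ Z') (_ : Epi ρ')
        (n : Z'' ⟶ G.obj (kernel π)), ρ' ≫ l ≫ G.map (pullback.snd i π) =
          n ≫ G.map (kernel.ι π) := hex.exact_up_to_refinements _ hlπ
    let ν : kernel π ⟶ pullback i π := pullback.lift 0 (kernel.ι π) (by simp)
    have hν₁ : ν ≫ pullback.fst i π = 0 := pullback.lift_fst _ _ _
    have hν₂ : ν ≫ pullback.snd i π = kernel.ι π := pullback.lift_snd _ _ _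
    have hν : n ≫ G.map ν = ρ' ≫ l := by
      rw [← cancel_mono (G.map (pullback.snd i π)), assoc, ← G.map_comp, assoc, hn, hν₂]
    rw [← cancel_epi ρ, ← cancel_epi ρ', hl, ← reassoc_of% hν, ← G.map_comp, hν₁]
    simp⟩
  exact preservesFiniteLimits_of_preservesMonomorphisms G

end Extension

/-! ### Additive functors and the restricted Yoneda functor -/

section AdditiveFunctorCategory

variable {C : Type*} {D : Type*} [Category* C] [Category* D] [Preadditive C] [Abelian D]

instance (J : Type*) [Category* J] [HasColimitsOfShape J D] :
    (additiveFunctor C D).IsClosedUnderColimitsOfShape J where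
  colimitsOfShape_le F := fun ⟨⟨K, π, hK⟩, hF⟩ => by
    refine (additiveFunctor_iff F).2 ⟨fun {X Y f g} => ?_⟩
    refine (isColimitOfPreserves ((evaluation C D).obj X) hK).hom_ext fun j => ?_
    have : (K.obj j).Additive := hF j
    simp [Preadditive.add_comp, Preadditive.comp_add, ← NatTrans.naturality]

instance (J : Type*) [Category* J] [HasLimitsOfShape J D] :
    (additiveFunctor C D).IsClosedUnderLimitsOfShape J where
  limitsOfShape_le F := fun ⟨⟨K, π, hK⟩, hF⟩ => by
    refine (additiveFunctor_iff F).2 ⟨fun {X Y f g} => ?_⟩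
    refine (isLimitOfPreserves ((evaluation C D).obj Y) hK).hom_ext fun j => ?_
    have : (K.obj j).Additive := hF j
    simp [Preadditive.add_comp, Preadditive.comp_add]

/-- The evaluation of additive functors at an object. -/
abbrev additiveEval (x : C) : (C ⥤+ D) ⥤ D :=
  AdditiveFunctor.forget C D ⋙ (evaluation C D).obj x

instance (x : C) : PreservesFiniteLimits (additiveEval (D := D) x) where
  preservesFiniteLimits _ _ _ := inferInstance

instance (x : C) : PreservesFiniteColimits (additiveEval (D := D) x) where
  preservesFiniteColimits _ _ _ := inferInstance

lemma additive_isZero_iff (M : C ⥤+ D) : IsZero M ↔ ∀ x, IsZero (M.obj.obj x) := by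
  simp only [IsZero.iff_id_eq_zero]
  refine ⟨fun h x => congr(($h).hom.app x), fun h => ?_⟩
  ext x
  exact h x

lemma additive_exact_iff (S : ShortComplex (C ⥤+ D)) :
    S.Exact ↔ ∀ x, (S.map (additiveEval x)).Exact := by
  simp only [ShortComplex.exact_iff_isZero_homology]
  rw [additive_isZero_iff]
  exact forall_congr' fun x => (S.mapHomologyIso (additiveEval x)).symm.isZero_iff

lemma additive_isIso_iff {M N : C ⥤+ D} (f : M ⟶ N) : IsIso f ↔ ∀ x, IsIso (f.hom.app x) := by
  refine ⟨fun _ x => inferInstanceAs (IsIso ((additiveEval x).map f)), fun h => ?_⟩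
  have (x : C) : IsIso (((AdditiveFunctor.forget C D).map f).app x) := h x
  have : IsIso ((AdditiveFunctor.forget C D).map f) := NatIso.isIso_of_isIso_app _
  exact isIso_of_reflects_iso f (AdditiveFunctor.forget C D)

lemma additive_epi_iff {M N : C ⥤+ D} (f : M ⟶ N) : Epi f ↔ ∀ x, Epi (f.hom.app x) := by
  refine ⟨fun _ x => inferInstanceAs (Epi ((additiveEval x).map f)), fun _ => ⟨fun g h w => ?_⟩⟩
  ext x
  rw [← cancel_epi (f.hom.app x)]
  exact congr(($w).hom.app x)

end AdditiveFunctorCategory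

section RestrictedYoneda

variable {T : Type u} [Category.{v} T] [Preadditive T]

instance : (restrictedYoneda T).Additive where
  map_add {X Y f g} := by
    ext c a
    exact Preadditive.comp_add _ _ _ _ _ _

/-- The object of `Mod-T^c` represented by a compact object. -/
abbrev rep (x : Compacts T) : ModCompacts T := (restrictedYoneda T).obj x.obj

/-- The action of a morphism `h X ⟶ M` on the morphisms from a compact object to `X`. -/
def evalHom {X : T} {M : ModCompacts T} (φ : (restrictedYoneda T).obj X ⟶ M) {c : Compacts T}
    (f : c.obj ⟶ X) : M.obj.obj (.op c) := φ.hom.app (.op c) f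

lemma evalHom_comp {X : T} {M N : ModCompacts T} (φ : (restrictedYoneda T).obj X ⟶ M)
    (ψ : M ⟶ N) {c : Compacts T} (f : c.obj ⟶ X) :
    evalHom (φ ≫ ψ) f = ψ.hom.app (.op c) (evalHom φ f) := rfl

lemma evalHom_map_comp {X Y : T} {M : ModCompacts T} (g : X ⟶ Y)
    (φ : (restrictedYoneda T).obj Y ⟶ M) {c : Compacts T} (f : c.obj ⟶ X) :
    evalHom ((restrictedYoneda T).map g ≫ φ) f = evalHom φ (f ≫ g) := rfl

lemma evalHom_precomp {X : T} {M : ModCompacts T} (φ : (restrictedYoneda T).obj X ⟶ M)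
    {c d : Compacts T} (g : d ⟶ c) (f : c.obj ⟶ X) :
    evalHom φ (g.hom ≫ f) = M.obj.map g.op (evalHom φ f) :=
  ConcreteCategory.congr_hom (φ.hom.naturality g.op) f

lemma evalHom_id_comp {x : Compacts T} {M : ModCompacts T} (φ : rep x ⟶ M) {c : Compacts T}
    (f : c.obj ⟶ x.obj) : evalHom φ f = M.obj.map (ObjectProperty.homMk f : c ⟶ x).op
      (evalHom φ (𝟙 x.obj)) := by
  rw [← evalHom_precomp]
  exact congrArg _ (comp_id f).symm

lemma hom_ext_of_evalHom {X : T} {M : ModCompacts T} {φ ψ : (restrictedYoneda T).obj X ⟶ M}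
    (h : ∀ (c : Compacts T) (f : c.obj ⟶ X), evalHom φ f = evalHom ψ f) : φ = ψ := by
  ext c f
  exact h c.unop f

lemma rep_hom_ext {x : Compacts T} {M : ModCompacts T} {φ ψ : rep x ⟶ M}
    (h : evalHom φ (𝟙 x.obj) = evalHom ψ (𝟙 x.obj)) : φ = ψ :=
  hom_ext_of_evalHom fun c f => by rw [evalHom_id_comp, evalHom_id_comp ψ, h]

/-- The morphism `h x ⟶ M` corresponding to an element of `M(x)`, for `x` compact. -/
def yonedaHom {x : Compacts T} {M : ModCompacts T} (m : M.obj.obj (.op x)) : rep x ⟶ M :=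
  ObjectProperty.homMk
    { app c := AddCommGrpCat.ofHom (AddMonoidHom.mk' (fun (f : c.unop.obj ⟶ x.obj) =>
        M.obj.map (ObjectProperty.homMk f : c.unop ⟶ x).op m) (fun f g => by
          change M.obj.map ((ObjectProperty.homMk f : c.unop ⟶ x) + ObjectProperty.homMk g).op m = _
          simp))
      naturality c c' g := by
        ext (f : c.unop.obj ⟶ x.obj)
        exact ConcreteCategory.congr_hom
          (M.obj.map_comp (ObjectProperty.homMk f : c.unop ⟶ x).op g) m }

lemma evalHom_yonedaHom {x : Compacts T} {M : ModCompacts T} (m : M.obj.obj (.op x)) :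
    evalHom (yonedaHom m) (𝟙 x.obj) = m := by
  change M.obj.map (𝟙 (Opposite.op x)) m = m
  simp

lemma restrictedYoneda_map_bijective {x : T} (hx : isCompact T x) (Y : T) :
    Function.Bijective ((restrictedYoneda T).map : (x ⟶ Y) → _) := by
  refine ⟨fun f g h => ?_, fun φ => ⟨evalHom φ (c := ⟨x, hx⟩) (𝟙 x), ?_⟩⟩
  · have h' : 𝟙 x ≫ f = 𝟙 x ≫ g := congr(evalHom $h (c := ⟨x, hx⟩) (𝟙 x))
    simpa using h'
  · exact rep_hom_ext (x := ⟨x, hx⟩) (id_comp (X := x) (Y := Y) (evalHom φ (c := ⟨x, hx⟩) (𝟙 x)))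

instance (x : Compacts T) : Projective (rep x) where
  factors {M N} φ p _ := by
    have := (AddCommGrpCat.epi_iff_surjective _).1 ((additive_epi_iff p).1 inferInstance (.op x))
    obtain ⟨m, hm⟩ := this (evalHom φ (𝟙 x.obj))
    refine ⟨yonedaHom m, rep_hom_ext ?_⟩
    rw [evalHom_comp, evalHom_yonedaHom, hm]

lemma epi_iff_surjective_evalHom {X : T} {M : ModCompacts T} (φ : (restrictedYoneda T).obj X ⟶ M) :
    Epi φ ↔ ∀ c : Compacts T, Function.Surjective (fun f : c.obj ⟶ X => evalHom φ f) := by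
  rw [additive_epi_iff]
  simp only [AddCommGrpCat.epi_iff_surjective]
  exact ⟨fun h c => h (.op c), fun h c => h c.unop⟩

lemma isIso_of_rep {M N : ModCompacts T} (φ : M ⟶ N)
    (h : ∀ x : Compacts T, Function.Bijective (fun ψ : rep x ⟶ M => ψ ≫ φ)) : IsIso φ := by
  rw [additive_isIso_iff]
  intro x
  rw [ConcreteCategory.isIso_iff_bijective]
  refine ⟨fun m m' hm => ?_, fun n => ?_⟩
  · have : yonedaHom (x := x.unop) m = yonedaHom m' := (h x.unop).1 (rep_hom_ext (by
      dsimp only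
      rw [evalHom_comp, evalHom_comp, evalHom_yonedaHom, evalHom_yonedaHom]
      exact hm))
    rw [← evalHom_yonedaHom (x := x.unop) m, this, evalHom_yonedaHom]
  · obtain ⟨ψ, hψ⟩ := (h x.unop).2 (yonedaHom n)
    refine ⟨evalHom ψ (𝟙 _), ?_⟩
    rw [← evalHom_yonedaHom (x := x.unop) n, ← hψ]
    rfl

instance (ι : Type v) : PreservesColimitsOfShape (Discrete ι) (restrictedYoneda T) where
  preservesColimit {K} := ⟨fun {c} hc => ⟨by
    refine isColimitOfReflects (AdditiveFunctor.forget _ _) ?_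
    refine evaluationJointlyReflectsColimits _ fun x => ?_
    have := x.unop.property ι
    exact isColimitOfPreserves (preadditiveCoyoneda.obj (.op x.unop.obj)) hc⟩⟩

variable (T) in
/-- The coproducts of compact objects. -/
def coproductOfCompacts : ObjectProperty T := fun X =>
  ∃ (ι : Type v) (x : ι → T) (c : Cofan x),
    (∀ i, isCompact T (x i)) ∧ Nonempty (IsColimit c) ∧ Nonempty (c.pt ≅ X)

lemma exists_cofan {X : T} (hX : coproductOfCompacts T X) :
    ∃ (ι : Type v) (x : ι → Compacts T) (s : ∀ i, (x i).obj ⟶ X),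
      Nonempty (IsColimit (Cofan.mk X s)) := by
  obtain ⟨ι, x, c, hx, ⟨hc⟩, ⟨e⟩⟩ := hX
  refine ⟨ι, fun i => ⟨x i, hx i⟩, fun i => c.inj i ≫ e.hom, ⟨hc.ofIsoColimit (Cocone.ext e ?_)⟩⟩
  intro i
  rfl

/-- A morphism from the coproduct of compact objects `X`, to be defined on the summands. -/
lemma exists_desc_of_cofan {X : T} {ι : Type v} {x : ι → Compacts T} {s : ∀ i, (x i).obj ⟶ X}
    (hX : IsColimit (Cofan.mk X s)) {M : ModCompacts T} (φ : ∀ i, rep (x i) ⟶ M) :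
    ∃ ψ : (restrictedYoneda T).obj X ⟶ M, ∀ i, (restrictedYoneda T).map (s i) ≫ ψ = φ i := by
  have hX' := isColimitCofanMkObjOfIsColimit (restrictedYoneda T) _ _ hX
  exact ⟨Cofan.IsColimit.desc hX' φ, fun i => Cofan.IsColimit.fac hX' φ i⟩

lemma hom_ext_of_cofan {X : T} {ι : Type v} {x : ι → Compacts T} {s : ∀ i, (x i).obj ⟶ X}
    (hX : IsColimit (Cofan.mk X s)) {M : ModCompacts T} {φ ψ : (restrictedYoneda T).obj X ⟶ M}
    (h : ∀ i, (restrictedYoneda T).map (s i) ≫ φ = (restrictedYoneda T).map (s i) ≫ ψ) :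
    φ = ψ :=
  Cofan.IsColimit.hom_ext (isColimitCofanMkObjOfIsColimit (restrictedYoneda T) _ _ hX) _ _ h

lemma restrictedYoneda_map_bijective_of_coproductOfCompacts {X : T}
    (hX : coproductOfCompacts T X) (Y : T) :
    Function.Bijective ((restrictedYoneda T).map : (X ⟶ Y) → _) := by
  obtain ⟨ι, x, s, ⟨hc⟩⟩ := exists_cofan hX
  refine ⟨fun f g h => ?_, fun φ => ?_⟩
  · refine Cofan.IsColimit.hom_ext hc _ _ fun i => ?_
    apply (restrictedYoneda_map_bijective (x i).property Y).1
    change (restrictedYoneda T).map (s i ≫ f) = (restrictedYoneda T).map (s i ≫ g)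
    rw [Functor.map_comp, Functor.map_comp, h]
  · choose f hf using fun i => (restrictedYoneda_map_bijective (x i).property Y).2
      ((restrictedYoneda T).map (s i) ≫ φ)
    refine ⟨Cofan.IsColimit.desc hc f, hom_ext_of_cofan hc fun i => ?_⟩
    rw [← hf i, ← Functor.map_comp]
    congr 1
    exact Cofan.IsColimit.fac hc f i

lemma projective_restrictedYoneda_obj {X : T} (hX : coproductOfCompacts T X) :
    Projective ((restrictedYoneda T).obj X) where
  factors {M N} φ p _ := by
    obtain ⟨ι, x, s, ⟨hc⟩⟩ := exists_cofan hX
    obtain ⟨ψ, hψ⟩ := exists_desc_of_cofan hc fun i =>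
      Projective.factorThru ((restrictedYoneda T).map (s i) ≫ φ) p
    refine ⟨ψ, hom_ext_of_cofan hc fun i => ?_⟩
    rw [reassoc_of% hψ, Projective.factorThru_comp]

/-- Every object of `Mod-T^c` is a quotient of `h X` for a coproduct `X` of compact objects, since
`T^c` is essentially small. -/
lemma exists_epi_restrictedYoneda [HasCoproducts.{v} T] [EssentiallySmall.{v} (Compacts T)]
    (M : ModCompacts T) :
    ∃ (X : T) (_ : coproductOfCompacts T X) (π : (restrictedYoneda T).obj X ⟶ M), Epi π := by
  let e := equivSmallModel.{v} (Compacts T)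
  let ι := Σ s : SmallModel.{v} (Compacts T), M.obj.obj (.op (e.inverse.obj s))
  let x (i : ι) : Compacts T := e.inverse.obj i.1
  let hc := coproductIsCoproduct fun i => (x i).obj
  obtain ⟨π, hπ⟩ := exists_desc_of_cofan (x := x) hc (M := M) fun i => yonedaHom i.2
  refine ⟨_, ⟨ι, fun i => (x i).obj, _, fun i => (x i).property, ⟨hc⟩, ⟨Iso.refl _⟩⟩, π, ?_⟩
  rw [epi_iff_surjective_evalHom]
  intro c m
  let u : c ≅ e.inverse.obj (e.functor.obj c) := e.unitIso.app c
  let i : ι := ⟨e.functor.obj c, M.obj.map u.inv.op m⟩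
  have h : evalHom π (Sigma.ι (fun i => (x i).obj) i) = M.obj.map u.inv.op m := by
    have := congr(evalHom $(hπ i) (𝟙 (x i).obj))
    rw [evalHom_yonedaHom, evalHom_map_comp, id_comp] at this
    exact this
  refine ⟨u.hom.hom ≫ Sigma.ι (fun i => (x i).obj) i, ?_⟩
  change evalHom π (u.hom.hom ≫ Sigma.ι (fun i => (x i).obj) i) = m
  rw [evalHom_precomp, h, ← ConcreteCategory.comp_apply, ← M.obj.map_comp, ← op_comp]
  simp

/-- `h` restricted to the coproducts of compact objects. -/
abbrev yonedaOnCoproducts (T : Type u) [Category.{v} T] [Preadditive T] :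
    (coproductOfCompacts T).FullSubcategory ⥤ ModCompacts T :=
  (coproductOfCompacts T).ι ⋙ restrictedYoneda T

lemma isProjectiveGenerating_yonedaOnCoproducts [HasCoproducts.{v} T]
    [EssentiallySmall.{v} (Compacts T)] : IsProjectiveGenerating (yonedaOnCoproducts T) where
  full := ⟨fun {X Y} φ => by
    obtain ⟨f, hf⟩ := (restrictedYoneda_map_bijective_of_coproductOfCompacts X.property Y.obj).2 φ
    exact ⟨ObjectProperty.homMk f, hf⟩⟩
  projective X := projective_restrictedYoneda_obj X.property
  exists_epi M := by
    obtain ⟨X, hX, π, hπ⟩ := exists_epi_restrictedYoneda M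
    exact ⟨⟨X, hX⟩, π, hπ⟩

section FinitelyPresented

attribute [local instance] Cardinal.fact_isRegular_aleph0

/-- Morphisms out of a representable functor are given by evaluation. -/
def repCoyonedaIso (x : Compacts T) : coyoneda.obj (.op (rep x)) ≅
    (additiveEval (.op x) ⋙ forget AddCommGrpCat.{v}) ⋙ uliftFunctor.{u} :=
  NatIso.ofComponents (fun M => Equiv.toIso
    { toFun φ := ⟨evalHom φ (𝟙 x.obj)⟩
      invFun m := yonedaHom m.down
      left_inv φ := rep_hom_ext (evalHom_yonedaHom _)
      right_inv m := congrArg ULift.up (evalHom_yonedaHom m.down) })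
    (fun {M N} f => by
      ext φ
      rfl)

instance (x : Compacts T) : IsFinitelyPresentable.{v} (rep x) := by
  rw [isFinitelyPresentable_iff_preservesFilteredColimitsOfSize]
  constructor
  intro J _ _
  exact preservesColimitsOfShape_of_natIso (repCoyonedaIso x).symm

lemma isFinitelyPresentable_cokernel {M N : ModCompacts T} [IsFinitelyPresentable.{v} M]
    [IsFinitelyPresentable.{v} N] (f : M ⟶ N) : IsFinitelyPresentable.{v} (cokernel f) := by
  have (k : WalkingParallelPair) :
      IsCardinalPresentable.{v} ((parallelPair f 0).obj k) Cardinal.aleph0 := by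
    cases k
    · exact inferInstanceAs (IsFinitelyPresentable.{v} M)
    · exact inferInstanceAs (IsFinitelyPresentable.{v} N)
  refine isCardinalPresentable_of_isColimit' _ (cokernelIsCokernel f) Cardinal.aleph0 ?_
  rw [hasCardinalLT_aleph0_iff]
  infer_instance

end FinitelyPresented

end RestrictedYoneda

/-! ### Compact objects of a triangulated category -/

section CompactObjects

variable {T : Type u} [Category.{v} T] [Preadditive T]

instance : (isCompact T).IsClosedUnderIsomorphisms where
  of_iso {x y} e hx ι := by
    have := hx ι
    exact preservesColimitsOfShape_of_natIso (preadditiveCoyoneda.mapIso e.symm.op)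

/-- The morphisms `c ⟶ X` which are finite sums of morphisms factoring through the structure
morphisms `s i : x i ⟶ X`. -/
def finiteMaps (c : T) {X : T} {ι : Type v} {x : ι → T} (s : ∀ i, x i ⟶ X) :
    AddSubgroup (c ⟶ X) :=
  ⨆ i, (Preadditive.rightComp c (s i)).range

section

variable {c X : T} {ι : Type v} {x : ι → T} {s : ∀ i, x i ⟶ X}

lemma comp_mem_finiteMaps {i : ι} (g : c ⟶ x i) : g ≫ s i ∈ finiteMaps c s :=
  (le_iSup (fun i => (Preadditive.rightComp c (s i)).range) i) ⟨g, rfl⟩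

lemma precomp_mem_finiteMaps {c' : T} (g : c' ⟶ c) {f : c ⟶ X} (hf : f ∈ finiteMaps c s) :
    g ≫ f ∈ finiteMaps c' s := by
  have : finiteMaps c s ≤ (finiteMaps c' s).comap (Preadditive.leftComp X g) := by
    refine iSup_le fun i => ?_
    rintro _ ⟨k, rfl⟩
    change g ≫ k ≫ s i ∈ finiteMaps c' s
    rw [← assoc]
    exact comp_mem_finiteMaps _
  exact this hf

variable {p : ∀ i, X ⟶ x i} (hp : ∀ i, s i ≫ p i = 𝟙 _) (hp' : ∀ i j, i ≠ j → s i ≫ p j = 0)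
include hp hp'

/-- A finite sum of morphisms through the summands is recovered from its components, given by the
projections `p`, over any large enough finite set of indices. -/
lemma exists_sum_of_mem_finiteMaps {f : c ⟶ X} (hf : f ∈ finiteMaps c s) :
    ∃ S : Finset ι, ∀ S', S ⊆ S' → f = ∑ i ∈ S', f ≫ p i ≫ s i := by
  classical
  have hadd {f g : c ⟶ X} (hf : ∃ S : Finset ι, ∀ S', S ⊆ S' → f = ∑ i ∈ S', f ≫ p i ≫ s i)
      (hg : ∃ S : Finset ι, ∀ S', S ⊆ S' → g = ∑ i ∈ S', g ≫ p i ≫ s i) :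
      ∃ S : Finset ι, ∀ S', S ⊆ S' → f + g = ∑ i ∈ S', (f + g) ≫ p i ≫ s i := by
    obtain ⟨S, hS⟩ := hf
    obtain ⟨R, hR⟩ := hg
    refine ⟨S ∪ R, fun S' h => ?_⟩
    simp only [Preadditive.add_comp, Finset.sum_add_distrib]
    rw [← hS S' (Finset.union_subset_left h), ← hR S' (Finset.union_subset_right h)]
  refine AddSubgroup.iSup_induction _ (C := fun f : c ⟶ X =>
    ∃ S : Finset ι, ∀ S', S ⊆ S' → f = ∑ i ∈ S', f ≫ p i ≫ s i) hf ?_ ?_ (fun f g => hadd)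
  · rintro i _ ⟨g, rfl⟩
    refine ⟨{i}, fun S' hS' => ?_⟩
    change g ≫ s i = ∑ j ∈ S', (g ≫ s i) ≫ p j ≫ s j
    rw [Finset.sum_eq_single i]
    · simp [reassoc_of% hp i]
    · intro j _ hj
      simp [reassoc_of% hp' i j hj.symm]
    · intro hi
      exact absurd (hS' (Finset.mem_singleton_self i)) hi
  · exact ⟨∅, fun S' _ => by simp⟩

omit hp in
lemma comp_eq_zero_of_eq_sum {f : c ⟶ X} {S : Finset ι} (hS : f = ∑ i ∈ S, f ≫ p i ≫ s i)
    {j : ι} (hj : j ∉ S) : f ≫ p j = 0 := by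
  rw [hS, Preadditive.sum_comp]
  refine Finset.sum_eq_zero fun i hi => ?_
  rw [assoc, assoc, hp' i j (by rintro rfl; exact hj hi), comp_zero, comp_zero]

end

/-- The projections from a coproduct onto its summands. -/
lemma exists_projections {X : T} {ι : Type v} {x : ι → T} {s : ∀ i, x i ⟶ X}
    (hc : IsColimit (Cofan.mk X s)) :
    ∃ p : ∀ i, X ⟶ x i, (∀ i, s i ≫ p i = 𝟙 _) ∧ ∀ i j, i ≠ j → s i ≫ p j = 0 := by
  classical
  have h (i j : ι) : s i ≫ Cofan.IsColimit.desc hc (fun k => if h : k = j then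
      eqToHom (by rw [h]) else 0) = if h : i = j then eqToHom (by rw [h]) else 0 :=
    Cofan.IsColimit.fac hc _ _
  refine ⟨fun j => Cofan.IsColimit.desc hc (fun k => if h : k = j then
    eqToHom (by rw [h]) else 0), fun i => ?_, fun i j hij => ?_⟩
  · simpa using h i i
  · simpa [hij] using h i j

/-- `Hom(c, X)` is the coproduct of the `Hom(c, x i)`, so it is generated by their images: the
quotient by the subgroup they generate is a map vanishing on each of them. -/
lemma mem_finiteMaps_of_isCompact {c : T} (h : isCompact T c) {X : T} {ι : Type v} {x : ι → T}
    {s : ∀ i, x i ⟶ X} (hc : IsColimit (Cofan.mk X s)) (f : c ⟶ X) : f ∈ finiteMaps c s := by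
  have := h ι
  have hc' := isColimitCofanMkObjOfIsColimit (preadditiveCoyoneda.obj (.op c)) _ _ hc
  have : AddCommGrpCat.ofHom (QuotientAddGroup.mk' (finiteMaps c s)) = 0 := by
    refine Cofan.IsColimit.hom_ext hc' _ _ fun i => ?_
    ext g
    exact (QuotientAddGroup.eq_zero_iff (N := finiteMaps c s) _).2 (comp_mem_finiteMaps (s := s) g)
  exact (QuotientAddGroup.eq_zero_iff (N := finiteMaps c s) f).1 (ConcreteCategory.congr_hom this f)

/-- An object is compact as soon as the morphisms from it to a coproduct are finite sums of
morphisms to the summands. -/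
lemma isCompact_of_mem_finiteMaps {c : T} (h : ∀ {X : T} {ι : Type v} {x : ι → T}
    {s : ∀ i, x i ⟶ X} (_ : IsColimit (Cofan.mk X s)) (f : c ⟶ X), f ∈ finiteMaps c s) :
    isCompact T c := by
  intro ι
  suffices ∀ (x : ι → T), PreservesColimit (Discrete.functor x) (preadditiveCoyoneda.obj (.op c)) from
    preservesColimitsOfShape_of_discrete _
  refine fun x => ⟨fun {cc} hc => ⟨?_⟩⟩
  let s (i : ι) : x i ⟶ cc.pt := cc.ι.app ⟨i⟩
  have hc' : IsColimit (Cofan.mk cc.pt s) :=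
    hc.ofIsoColimit (Cocone.ext (Iso.refl _) (by rintro ⟨i⟩; exact comp_id _))
  let p := (exists_projections hc').choose
  obtain ⟨hp, hp'⟩ : (∀ i, s i ≫ p i = 𝟙 _) ∧ ∀ i j, i ≠ j → s i ≫ p j = 0 :=
    (exists_projections hc').choose_spec
  choose S hS using fun f : c ⟶ cc.pt => exists_sum_of_mem_finiteMaps hp hp' (h hc' f)
  have hS0 (f : c ⟶ cc.pt) (S' : Finset ι) (h' : S f ⊆ S') (j : ι) (hj : j ∉ S') : f ≫ p j = 0 :=
    comp_eq_zero_of_eq_sum hp' (hS f S' h') hj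
  let t (t : Cocone (Discrete.functor x ⋙ preadditiveCoyoneda.obj (.op c))) (i : ι) :
    (c ⟶ x i) →+ t.pt := (t.ι.app ⟨i⟩).hom
  have key (u : Cocone (Discrete.functor x ⋙ preadditiveCoyoneda.obj (.op c))) (f : c ⟶ cc.pt)
      (S' : Finset ι) (h' : S f ⊆ S') : ∑ i ∈ S f, t u i (f ≫ p i) = ∑ i ∈ S', t u i (f ≫ p i) := by
    refine Finset.sum_subset h' fun i _ hi => ?_
    rw [hS0 f (S f) subset_rfl i hi, map_zero]
  classical
  exact
    { desc u := AddCommGrpCat.ofHom (AddMonoidHom.mk' (fun f : c ⟶ cc.pt =>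
        ∑ i ∈ S f, t u i (f ≫ p i)) (fun f g => by
          let S' := S (f + g) ∪ (S f ∪ S g)
          rw [key u (f + g) S' Finset.subset_union_left,
            key u f S' (Finset.subset_union_left.trans Finset.subset_union_right),
            key u g S' (Finset.subset_union_right.trans Finset.subset_union_right),
            ← Finset.sum_add_distrib]
          refine Finset.sum_congr rfl fun i _ => ?_
          exact (congrArg (t u i) (Preadditive.add_comp _ _ _ f g (p i))).trans (map_add _ _ _)))
      fac u := by
        rintro ⟨i⟩
        ext (g : c ⟶ x i)
        change ∑ j ∈ S (g ≫ s i), t u j ((g ≫ s i) ≫ p j) = t u i g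
        rw [key u (g ≫ s i) (S (g ≫ s i) ∪ {i}) Finset.subset_union_left,
          Finset.sum_eq_single i]
        · rw [assoc, hp i, comp_id]
        · intro j _ hj
          rw [assoc, hp' i j hj.symm, comp_zero, map_zero]
        · intro hi
          exact absurd (Finset.mem_union_right _ (Finset.mem_singleton_self i)) hi
      uniq u m hm := by
        ext (f : c ⟶ cc.pt)
        change m.hom f = ∑ j ∈ S f, t u j (f ≫ p j)
        conv_lhs => rw [hS f (S f) subset_rfl]
        refine (map_sum m.hom _ _).trans (Finset.sum_congr rfl fun i _ => ?_)
        rw [← assoc]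
        have hi : AddCommGrpCat.ofHom (Preadditive.rightComp c (s i)) ≫ m = u.ι.app ⟨i⟩ := hm ⟨i⟩
        exact ConcreteCategory.congr_hom hi (show c ⟶ x i from f ≫ p i) }

lemma isCompact_biproduct {n : Type} [Finite n] (x : n → T) [HasBiproduct x]
    (hx : ∀ i, isCompact T (x i)) : isCompact T (⨁ x) := by
  have := Fintype.ofFinite n
  refine isCompact_of_mem_finiteMaps fun {X ι y s} hc f => ?_
  have hf : f = ∑ i, (biproduct.π x i ≫ biproduct.ι x i) ≫ f := by
    rw [← Preadditive.sum_comp, biproduct.total]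
    exact (id_comp f).symm
  rw [hf]
  refine sum_mem fun i _ => ?_
  rw [assoc]
  exact precomp_mem_finiteMaps _ (mem_finiteMaps_of_isCompact (hx i) hc _)

/-- A morphism from a compact object to the image of a coproduct of compact objects is fixed by
an idempotent coming from a finite subcoproduct. -/
lemma exists_factorization {K : Type u₁} [Category.{v} K] [Preadditive K] [HasFiniteBiproducts T]
    (F : T ⥤ K) [F.Additive] [∀ ι : Type v, PreservesColimitsOfShape (Discrete ι) F]
    {P : T} (hP : coproductOfCompacts T P) {c : K} (hc : isCompact K c) (g : c ⟶ F.obj P) :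
    ∃ (x : Compacts T) (r : P ⟶ x.obj) (s : x.obj ⟶ P), g ≫ F.map r ≫ F.map s = g := by
  obtain ⟨ι, x, s, ⟨hs⟩⟩ := exists_cofan hP
  obtain ⟨p, hp, hp'⟩ := exists_projections hs
  obtain ⟨S, hS⟩ := exists_sum_of_mem_finiteMaps (p := fun i => F.map (p i))
    (fun i => by rw [← F.map_comp, hp i, F.map_id])
    (fun i j hij => by rw [← F.map_comp, hp' i j hij, F.map_zero])
    (mem_finiteMaps_of_isCompact hc (isColimitCofanMkObjOfIsColimit F _ _ hs) g)
  let e := S.equivFin.symm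
  refine ⟨⟨⨁ fun i => (x (e i)).obj, isCompact_biproduct _ fun i => (x (e i)).property⟩,
    biproduct.lift fun i => p (e i), biproduct.desc fun i => s (e i), ?_⟩
  have h : (biproduct.lift fun i => p (e i)) ≫ (biproduct.desc fun i => s (e i)) =
      ∑ i, p (e i) ≫ s (e i) := biproduct.lift_desc
  rw [← F.map_comp, h, F.map_sum, Preadditive.comp_sum]
  conv_rhs => rw [hS S subset_rfl]
  rw [← Finset.sum_coe_sort S, ← e.sum_comp]
  simp only [F.map_comp]

end CompactObjects

section Rigid

variable {T : Type u₁} [Category.{v} T] [MonoidalCategory T]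
  {K : Type u₂} [Category.{v} K] [MonoidalCategory K]

open Functor.LaxMonoidal Functor.OplaxMonoidal in
/-- Strong monoidal functors preserve duals. -/
lemma isRigid_obj (F : T ⥤ K) [F.Monoidal] {x : T} (hx : isRigid x) : isRigid (F.obj x) := by
  obtain ⟨y, ⟨e⟩⟩ := hx
  refine ⟨F.obj y, ⟨{
    coevaluation' := ε F ≫ F.map (η_ x y) ≫ δ F x y
    evaluation' := μ F y x ≫ F.map (ε_ x y) ≫ η F
    coevaluation_evaluation' := ?_
    evaluation_coevaluation' := ?_ }⟩⟩
  · have h : F.obj y ◁ (ε F ≫ F.map (η_ x y) ≫ δ F x y) ≫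
        (α_ (F.obj y) (F.obj x) (F.obj y)).inv ≫ (μ F y x ≫ F.map (ε_ x y) ≫ η F) ▷ F.obj y =
        F.obj y ◁ ε F ≫ μ F y (𝟙_ T) ≫ F.map (y ◁ η_ x y ≫ (α_ y x y).inv ≫ ε_ x y ▷ y) ≫
          δ F (𝟙_ T) y ≫ η F ▷ F.obj y := by
      simp only [Functor.map_comp, Functor.Monoidal.map_whiskerLeft,
        Functor.Monoidal.map_whiskerRight, Functor.Monoidal.map_associator_inv, assoc,
        Functor.Monoidal.μ_δ_assoc, MonoidalCategory.whiskerLeft_comp, comp_whiskerRight]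
    rw [h, ExactPairing.coevaluation_evaluation]
    simp
  · have h : (ε F ≫ F.map (η_ x y) ≫ δ F x y) ▷ F.obj x ≫
        (α_ (F.obj x) (F.obj y) (F.obj x)).hom ≫ F.obj x ◁ (μ F y x ≫ F.map (ε_ x y) ≫ η F) =
        ε F ▷ F.obj x ≫ μ F (𝟙_ T) x ≫ F.map (η_ x y ▷ x ≫ (α_ x y x).hom ≫ x ◁ ε_ x y) ≫
          δ F x (𝟙_ T) ≫ F.obj x ◁ η F := by
      simp only [Functor.map_comp, Functor.Monoidal.map_whiskerLeft,
        Functor.Monoidal.map_whiskerRight, Functor.Monoidal.map_associator, assoc,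
        Functor.Monoidal.μ_δ_assoc, MonoidalCategory.whiskerLeft_comp, comp_whiskerRight]
    rw [h, ExactPairing.evaluation_coevaluation]
    simp

end Rigid

section Triangulated

variable {T : Type u} [Category.{v} T] [Preadditive T] [HasShift T ℤ]
  [∀ n : ℤ, (shiftFunctor T n).Additive]

lemma isCompact_shift {x : T} (hx : isCompact T x) (n : ℤ) : isCompact T (x⟦n⟧) := by
  refine isCompact_of_mem_finiteMaps fun {X ι y s} hc f => ?_
  obtain ⟨p, hp, hp'⟩ := exists_projections hc
  have hx' : isCompact T (x⟦n⟧⟦-n⟧) :=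
    (isCompact T).prop_of_iso ((shiftEquiv T n).unitIso.app x) hx
  obtain ⟨S, hS⟩ := exists_sum_of_mem_finiteMaps (p := fun i => (p i)⟦-n⟧')
    (fun i => by rw [← Functor.map_comp, hp i, CategoryTheory.Functor.map_id])
    (fun i j hij => by rw [← Functor.map_comp, hp' i j hij, Functor.map_zero])
    (mem_finiteMaps_of_isCompact hx' (isColimitCofanMkObjOfIsColimit (shiftFunctor T (-n)) _ _ hc) (f⟦-n⟧'))
  have : f = ∑ i ∈ S, f ≫ p i ≫ s i := by
    apply (shiftFunctor T (-n)).map_injective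
    rw [Functor.map_sum, hS S subset_rfl]
    simp only [Functor.map_comp]
  rw [this]
  refine sum_mem fun i _ => ?_
  rw [← assoc]
  exact comp_mem_finiteMaps _

lemma coproductOfCompacts_shift {X : T} (hX : coproductOfCompacts T X) (n : ℤ) :
    coproductOfCompacts T (X⟦n⟧) := by
  obtain ⟨ι, x, s, ⟨hs⟩⟩ := exists_cofan hX
  exact ⟨ι, _, _, fun i => isCompact_shift (x i).property n,
    ⟨isColimitCofanMkObjOfIsColimit (shiftFunctor T n) _ _ hs⟩, ⟨Iso.refl _⟩⟩

variable [HasZeroObject T] [Pretriangulated T]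

open Pretriangulated

instance isTriangulated_isCompact : (isCompact T).IsTriangulated where
  exists_zero := ⟨_, isZero_zero T, isCompact_of_mem_finiteMaps fun {X ι y s} hc f => by
    rw [(isZero_zero T).eq_of_src f 0]
    exact zero_mem _⟩
  isStableUnderShiftBy n := ⟨fun x hx => isCompact_shift hx n⟩
  -- correct `f` by finitely many of its components to make it vanish on `Δ.obj₁`, so that it
  -- factors through `Δ.obj₃`
  toIsTriangulatedClosed₂ := .mk' fun Δ hΔ h₁ h₃ => isCompact_of_mem_finiteMaps
    fun {X ι y s} hc f => by
      obtain ⟨p, hp, hp'⟩ := exists_projections hc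
      obtain ⟨S, hS⟩ := exists_sum_of_mem_finiteMaps hp hp' (mem_finiteMaps_of_isCompact h₁ hc (Δ.mor₁ ≫ f))
      have h : Δ.mor₁ ≫ (f - ∑ i ∈ S, f ≫ p i ≫ s i) = 0 := by
        rw [Preadditive.comp_sub, Preadditive.comp_sum, sub_eq_zero]
        refine (hS S subset_rfl).trans (Finset.sum_congr rfl fun i _ => assoc _ _ _)
      obtain ⟨g, hg⟩ := Δ.yoneda_exact₂ hΔ _ h
      rw [sub_eq_iff_eq_add] at hg
      rw [hg]
      refine add_mem (precomp_mem_finiteMaps _ (mem_finiteMaps_of_isCompact h₃ hc g))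
        (sum_mem fun i _ => ?_)
      rw [← assoc]
      exact comp_mem_finiteMaps _

instance : (restrictedYoneda T).IsHomological where
  exact Δ hΔ := by
    rw [additive_exact_iff]
    exact fun x => (preadditiveCoyoneda.obj (.op x.unop.obj)).map_distinguished_exact Δ hΔ

end Triangulated

/-! ### Extension and restriction of modules along a functor -/

section Restriction

variable {T : Type u₁} [Category.{v} T] [Preadditive T]
  {K : Type u₂} [Category.{v} K] [Preadditive K]
  (F : T ⥤ K) [F.Additive] (hF : ∀ x, isCompact T x → isCompact K (F.obj x))

/-- The functor between categories of compact objects induced by a functor which preserves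
compact objects. -/
abbrev compactsMap : Compacts T ⥤ Compacts K :=
  (isCompact K).lift ((isCompact T).ι ⋙ F) fun x => hF x.obj x.property

instance : (compactsMap F hF).Additive where
  map_add {x y f g} := by
    apply (isCompact K).ι.map_injective
    exact F.map_add

/-- The restriction functor `Mod-K^c ⥤ Mod-T^c` along `F`. -/
def restriction : ModCompacts K ⥤ ModCompacts T :=
  (additiveFunctor _ _).lift
    (AdditiveFunctor.forget _ _ ⋙ (Functor.whiskeringLeft _ _ _).obj (compactsMap F hF).op)
    (fun N => (additiveFunctor_iff _).2 (by
      have : N.obj.Additive := N.property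
      exact inferInstanceAs ((compactsMap F hF).op ⋙ N.obj).Additive))

instance : PreservesColimitsOfSize.{v, v} (restriction F hF) where
  preservesColimitsOfShape {J} _ := ⟨fun {R} => ⟨fun {c} hc => ⟨by
    refine isColimitOfReflects (AdditiveFunctor.forget _ _) ?_
    refine evaluationJointlyReflectsColimits _ fun x => ?_
    exact isColimitOfPreserves (additiveEval ((compactsMap F hF).op.obj x)) hc⟩⟩⟩

/-- The natural morphism `h X ⟶ h (F X) ∘ F` given by the action of `F` on morphisms. -/
def restrictionUnit (X : T) : (restrictedYoneda T).obj X ⟶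
    (restriction F hF).obj ((restrictedYoneda K).obj (F.obj X)) :=
  ObjectProperty.homMk
    { app c := AddCommGrpCat.ofHom (F.mapAddHom (X := c.unop.obj) (Y := X))
      naturality c c' g := by
        ext (f : c.unop.obj ⟶ X)
        exact F.map_comp _ _ }

lemma restrictionUnit_naturality {X Y : T} (g : X ⟶ Y) :
    (restrictedYoneda T).map g ≫ restrictionUnit F hF Y = restrictionUnit F hF X ≫
      (restriction F hF).map ((restrictedYoneda K).map (F.map g)) :=
  hom_ext_of_evalHom fun _ _ => F.map_comp _ _

variable [∀ ι : Type v, PreservesColimitsOfShape (Discrete ι) F]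

/-- For a coproduct `X` of compact objects, the morphism `h X ⟶ h (F X) ∘ F` is universal. -/
lemma restrictionUnit_bijective {X : T} (hX : coproductOfCompacts T X) (N : ModCompacts K) :
    Function.Bijective fun φ : (restrictedYoneda K).obj (F.obj X) ⟶ N =>
      restrictionUnit F hF X ≫ (restriction F hF).map φ := by
  obtain ⟨ι, x, s, ⟨hs⟩⟩ := exists_cofan hX
  let y (i : ι) : Compacts K := (compactsMap F hF).obj (x i)
  let t (i : ι) : (y i).obj ⟶ F.obj X := F.map (s i)
  have hFs : IsColimit (Cofan.mk (F.obj X) t) := isColimitCofanMkObjOfIsColimit F _ _ hs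
  have key (φ : (restrictedYoneda K).obj (F.obj X) ⟶ N) (i : ι) :
      evalHom ((restrictedYoneda T).map (s i) ≫ restrictionUnit F hF X ≫
        (restriction F hF).map φ) (𝟙 (x i).obj) =
      evalHom ((restrictedYoneda K).map (t i) ≫ φ) (𝟙 (y i).obj) := by
    have h : F.map (𝟙 (x i).obj ≫ s i) = 𝟙 (y i).obj ≫ t i :=
      (congrArg F.map (id_comp (s i))).trans (id_comp (t i)).symm
    exact congrArg (evalHom (c := y i) φ) h
  refine ⟨fun φ φ' h => ?_, fun ψ => ?_⟩
  · refine hom_ext_of_cofan hFs fun i => rep_hom_ext ?_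
    dsimp only at h
    rw [← key, ← key, h]
  · let n (i : ι) : N.obj.obj (.op (y i)) :=
      evalHom ((restrictedYoneda T).map (s i) ≫ ψ) (𝟙 (x i).obj)
    obtain ⟨φ, hφ⟩ := exists_desc_of_cofan hFs fun i => yonedaHom (n i)
    refine ⟨φ, hom_ext_of_cofan hs fun i => rep_hom_ext ?_⟩
    refine (key φ i).trans ?_
    rw [hφ]
    exact evalHom_yonedaHom (n i)

variable [HasCoproducts.{v} T] [EssentiallySmall.{v} (Compacts T)]

/-- Restriction along `F` has a left adjoint: it is defined on `h X`, where it takes the value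
`h (F X)`, for `X` a coproduct of compact objects, and every object is a cokernel of a morphism
between such objects. -/
instance isRightAdjoint_restriction : (restriction F hF).IsRightAdjoint := by
  have h₀ (X : (coproductOfCompacts T).FullSubcategory) :
      (restriction F hF).leftAdjointObjIsDefined ((yonedaOnCoproducts T).obj X) :=
    Functor.CorepresentableBy.isCorepresentable (X := (restrictedYoneda K).obj (F.obj X.obj))
      { homEquiv {N} := Equiv.ofBijective (fun φ : (restrictedYoneda K).obj (F.obj X.obj) ⟶ N =>
          restrictionUnit F hF X.obj ≫ (restriction F hF).map φ)
          (restrictionUnit_bijective F hF X.property N)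
        homEquiv_comp {N N'} g φ := by
          change restrictionUnit F hF X.obj ≫ (restriction F hF).map (φ ≫ g) =
            (restrictionUnit F hF X.obj ≫ (restriction F hF).map φ) ≫
              (restriction F hF).map g
          rw [Functor.map_comp, assoc] }
  apply Functor.isRightAdjoint_of_leftAdjointObjIsDefined_eq_top
  ext M
  simp only [Pi.top_apply, Prop.top_eq_true, iff_true]
  obtain ⟨p₀, p₁, f, π, w, hπ, hw⟩ :=
    (isProjectiveGenerating_yonedaOnCoproducts (T := T)).exists_presentation M
  have : Epi (ShortComplex.mk _ _ w).g := hπ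
  refine Functor.leftAdjointObjIsDefined_of_isColimit hw.gIsCokernel ?_
  rintro (_ | _)
  · exact h₀ p₁
  · exact h₀ p₀

/-- The cocontinuous extension `Mod-T^c ⥤ Mod-K^c` of `F`: the left adjoint of the restriction. -/
def extension : ModCompacts T ⥤ ModCompacts K := (restriction F hF).leftAdjoint

/-- The adjunction between extension and restriction. -/
def extensionAdjunction : extension F hF ⊣ restriction F hF :=
  Adjunction.ofIsRightAdjoint (restriction F hF)

instance : PreservesColimitsOfSize.{v, v} (extension F hF) :=
  (extensionAdjunction F hF).leftAdjoint_preservesColimits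

instance : PreservesFiniteColimits (extension F hF) where
  preservesFiniteColimits _ _ _ :=
    (extensionAdjunction F hF).leftAdjoint_preservesColimits.{0, 0}.preservesColimitsOfShape

instance : (extension F hF).Additive := additive_of_preservesFiniteColimits _

/-- The comparison of the extension of `F` with `F`. -/
def extensionComparison : restrictedYoneda T ⋙ extension F hF ⟶ F ⋙ restrictedYoneda K where
  app X := ((extensionAdjunction F hF).homEquiv ((restrictedYoneda T).obj X)
    ((restrictedYoneda K).obj (F.obj X))).symm (restrictionUnit F hF X)
  naturality X Y f := by
    have h₁ := (extensionAdjunction F hF).homEquiv_naturality_left_symm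
      ((restrictedYoneda T).map f) (restrictionUnit F hF Y)
    have h₂ := (extensionAdjunction F hF).homEquiv_naturality_right_symm
      (restrictionUnit F hF X) ((restrictedYoneda K).map (F.map f))
    rw [restrictionUnit_naturality] at h₁
    exact h₁.symm.trans h₂

lemma isIso_extensionComparison_app {X : T} (hX : coproductOfCompacts T X) :
    IsIso ((extensionComparison F hF).app X) := by
  rw [isIso_iff_coyoneda_map_bijective]
  intro N
  have h (φ : (restrictedYoneda K).obj (F.obj X) ⟶ N) :
      (extensionAdjunction F hF).homEquiv ((restrictedYoneda T).obj X) N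
        ((extensionComparison F hF).app X ≫ φ) =
      restrictionUnit F hF X ≫ (restriction F hF).map φ := by
    have h' := (extensionAdjunction F hF).homEquiv_naturality_right
      ((extensionComparison F hF).app X) φ
    exact h'.trans (congrArg (· ≫ (restriction F hF).map φ) (Equiv.apply_symm_apply _ _))
  refine (Function.Bijective.of_comp_iff'
    ((extensionAdjunction F hF).homEquiv ((restrictedYoneda T).obj X) N).bijective _).1 ?_
  convert restrictionUnit_bijective F hF hX N using 1
  exact funext h

end Restriction

section Fibers

variable {T : Type u₁} [Category.{v} T] [Preadditive T] [HasZeroObject T] [HasShift T ℤ]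
  [∀ n : ℤ, (shiftFunctor T n).Additive] [Pretriangulated T]
  {K : Type u₂} [Category.{v} K] [Preadditive K] [HasZeroObject K] [HasShift K ℤ]
  [∀ n : ℤ, (shiftFunctor K n).Additive] [Pretriangulated K]
  (F : T ⥤ K) [F.CommShift ℤ] [F.IsTriangulated]
  [∀ ι : Type v, PreservesColimitsOfShape (Discrete ι) F]

open Pretriangulated

/-- Let `W` be the fiber of a morphism between coproducts of compact objects. Morphisms from a
compact object to `F W` are sums of morphisms factoring through images of morphisms from compact
objects to `W`; hence they lift along `F u` as soon as the morphisms from compact objects to `W`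
lift along `u`. -/
lemma exists_lift_of_fiber {W P₁ P₀ : T} {i : W ⟶ P₁} {f : P₁ ⟶ P₀} {δ : P₀ ⟶ W⟦(1 : ℤ)⟧}
    (hΔ : Triangle.mk i f δ ∈ distTriang T) (h₁ : coproductOfCompacts T P₁)
    (h₀ : coproductOfCompacts T P₀) {P : T} (u : P ⟶ W)
    (hu : ∀ (x : T) (_ : isCompact T x) (k : x ⟶ W), ∃ k' : x ⟶ P, k' ≫ u = k)
    {c : K} (hc : isCompact K c) (g : c ⟶ F.obj W) : ∃ g' : c ⟶ F.obj P, g' ≫ F.map u = g := by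
  have wif : i ≫ f = 0 := comp_distTriang_mor_zero₁₂ _ hΔ
  obtain ⟨x₁, r₁, s₁, h₁⟩ := exists_factorization F h₁ hc (g ≫ F.map i)
  obtain ⟨x₀, r₀, s₀, h₀'⟩ := exists_factorization (𝟭 T) h₀ x₁.property (s₁ ≫ f)
  replace h₀' : (s₁ ≫ f) ≫ r₀ ≫ s₀ = s₁ ≫ f := h₀'
  obtain ⟨y, hy, j, δ', hΔ'⟩ := (isCompact T).distinguished_cocone_triangle₁ (s₁ ≫ f ≫ r₀)
    x₁.property x₀.property
  obtain ⟨(k : y ⟶ W), hk, -⟩ := complete_distinguished_triangle_morphism₁ _ _ hΔ' hΔ s₁ s₀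
    (show (s₁ ≫ f ≫ r₀) ≫ s₀ = s₁ ≫ f by simpa using h₀')
  replace hk : j ≫ s₁ = k ≫ i := hk
  -- `g` followed by `W ⟶ P₁` factors through the compact fiber `y` of `x₁ ⟶ x₀`
  have hg₂ : (g ≫ F.map i ≫ F.map r₁) ≫ F.map (s₁ ≫ f ≫ r₀) = 0 := by
    have := h₁ =≫ F.map (f ≫ r₀)
    simp only [assoc, ← F.map_comp] at this ⊢
    rw [this, reassoc_of% wif, zero_comp, F.map_zero, comp_zero]
  obtain ⟨g₂, hg₂⟩ : ∃ g₂ : c ⟶ F.obj y, g ≫ F.map i ≫ F.map r₁ = g₂ ≫ F.map j :=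
    Triangle.coyoneda_exact₂ _ (F.map_distinguished _ hΔ') _ hg₂
  -- the remaining difference vanishes in `F P₁`, so it comes from `F (P₀⟦-1⟧)`
  have hg₃ : (g - g₂ ≫ F.map k) ≫ F.map i = 0 := by
    rw [Preadditive.sub_comp, assoc, ← F.map_comp, ← hk, F.map_comp, ← reassoc_of% hg₂, sub_eq_zero]
    simpa using h₁.symm
  obtain ⟨δ₀, g₃, hg₃⟩ : ∃ (δ₀ : P₀⟦(-1 : ℤ)⟧ ⟶ W) (g₃ : c ⟶ F.obj (P₀⟦(-1 : ℤ)⟧)),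
      g - g₂ ≫ F.map k = g₃ ≫ F.map δ₀ :=
    ⟨_, Triangle.coyoneda_exact₂ _ (F.map_distinguished _ (inv_rot_of_distTriang _ hΔ)) _ hg₃⟩
  obtain ⟨x₃, r₃, s₃, h₃⟩ := exists_factorization F (coproductOfCompacts_shift h₀ (-1)) hc g₃
  obtain ⟨k', rfl⟩ := hu y hy k
  obtain ⟨l, hl⟩ := hu x₃.obj x₃.property (s₃ ≫ δ₀)
  refine ⟨g₂ ≫ F.map k' + g₃ ≫ F.map r₃ ≫ F.map l, ?_⟩
  rw [sub_eq_iff_eq_add] at hg₃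
  rw [hg₃, Preadditive.add_comp, add_comm]
  congr 1
  · conv_rhs => rw [← h₃]
    simp only [assoc, ← F.map_comp, hl]
  · simp

end Fibers

/-! ### Exactness of the extension -/

open Pretriangulated

lemma exact_of_epi_comp {A : Type*} [Category* A] [Abelian A] {X' X Y Z : A} (e : X' ⟶ X) [Epi e]
    {f : X ⟶ Y} {g : Y ⟶ Z} (w : f ≫ g = 0) (h : (ShortComplex.mk f g w).Exact)
    {f' : X' ⟶ Y} (hf : e ≫ f = f') :
    ∃ w' : f' ≫ g = 0, (ShortComplex.mk f' g w').Exact := by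
  subst hf
  have w' : (e ≫ f) ≫ g = 0 := by rw [assoc, w, comp_zero]
  let φ : ShortComplex.mk (e ≫ f) g w' ⟶ ShortComplex.mk f g w :=
    { τ₁ := e
      τ₂ := 𝟙 Y
      τ₃ := 𝟙 Z }
  have : Epi φ.τ₁ := ‹_›
  have : IsIso φ.τ₂ := inferInstanceAs (IsIso (𝟙 Y))
  have : Mono φ.τ₃ := inferInstanceAs (Mono (𝟙 Z))
  exact ⟨w', (ShortComplex.exact_iff_of_epi_of_isIso_of_mono φ).2 h⟩

lemma coproductOfCompacts_of_isCompact {T : Type u} [Category.{v} T] [Preadditive T] {x : T}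
    (hx : isCompact T x) : coproductOfCompacts T x :=
  ⟨PUnit, fun _ => x, Cofan.mk x fun _ => 𝟙 x, fun _ => hx,
    ⟨Cofan.IsColimit.mk _ (fun s => s.inj ⟨⟩) (fun _ _ => id_comp _)
      (fun _ _ hm => (id_comp _).symm.trans (hm ⟨⟩))⟩, ⟨Iso.refl _⟩⟩

section Homological

variable {T : Type*} [Category* T] [Preadditive T] [HasZeroObject T] [HasShift T ℤ]
  [∀ n : ℤ, (shiftFunctor T n).Additive] [Pretriangulated T] {A : Type*} [Category* A] [Abelian A]

/-- The five lemma for natural transformations between homological functors. -/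
lemma isIso_app_obj₂ {G G' : T ⥤ A} [G.IsHomological] [G'.IsHomological] (α : G ⟶ G')
    (Δ : Triangle T) (hΔ : Δ ∈ distTriang T) (h₁ : IsIso (α.app Δ.obj₁)) (h₃ : IsIso (α.app Δ.obj₃))
    (h₀ : IsIso (α.app (Δ.obj₃⟦(-1 : ℤ)⟧))) (h₄ : IsIso (α.app (Δ.obj₁⟦(1 : ℤ)⟧))) :
    IsIso (α.app Δ.obj₂) := by
  let R (H : T ⥤ A) : ComposableArrows A 4 :=
    .mk₄ (H.map Δ.invRotate.mor₁) (H.map Δ.mor₁) (H.map Δ.mor₂) (H.map Δ.mor₃)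
  have hR (H : T ⥤ A) [H.IsHomological] : (R H).Exact :=
    ComposableArrows.exact_of_δ₀
      (H.map_distinguished_exact _ (inv_rot_of_distTriang _ hΔ)).exact_toComposableArrows
      (ComposableArrows.exact_of_δ₀
        (H.map_distinguished_exact _ hΔ).exact_toComposableArrows
        (H.map_distinguished_exact _ (rot_of_distTriang _ hΔ)).exact_toComposableArrows)
  let φ : R G ⟶ R G' := ComposableArrows.homMk₄ (α.app _) (α.app _) (α.app _) (α.app _) (α.app _)
    (α.naturality _) (α.naturality _) (α.naturality _) (α.naturality _)
  exact Abelian.isIso_of_epi_of_isIso_of_isIso_of_mono (hR G) (hR G') φ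
    (inferInstanceAs (Epi (α.app (Δ.obj₃⟦(-1 : ℤ)⟧)))) h₁ h₃
    (inferInstanceAs (Mono (α.app (Δ.obj₁⟦(1 : ℤ)⟧))))

/-- The objects at which, along with all their shifts, a natural transformation is invertible. -/
def isoLocus {G G' : T ⥤ A} (α : G ⟶ G') : ObjectProperty T :=
  fun X => ∀ n : ℤ, IsIso (α.app (X⟦n⟧))

instance {G G' : T ⥤ A} (α : G ⟶ G') : (isoLocus α).IsClosedUnderIsomorphisms where
  of_iso e hX n := (NatTrans.isIso_app_iff_of_iso α ((shiftFunctor T n).mapIso e)).1 (hX n)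

instance {G G' : T ⥤ A} [G.IsHomological] [G'.IsHomological] (α : G ⟶ G') :
    (isoLocus α).IsTriangulated where
  exists_zero := ⟨_, isZero_zero T, fun n =>
    have h := (shiftFunctor T n).map_isZero (isZero_zero T)
    ⟨0, (G.map_isZero h).eq_of_src _ _, (G'.map_isZero h).eq_of_src _ _⟩⟩
  isStableUnderShiftBy n := ⟨fun X hX m =>
    (NatTrans.isIso_app_iff_of_iso α ((shiftFunctorAdd T n m).app X)).1 (hX (n + m))⟩
  toIsTriangulatedClosed₂ := .mk' fun Δ hΔ h₁ h₃ n =>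
    isIso_app_obj₂ α _ (Δ.shift_distinguished hΔ n) (h₁ n) (h₃ n)
      ((NatTrans.isIso_app_iff_of_iso α ((shiftFunctorAdd T n (-1)).app Δ.obj₃)).1 (h₃ (n + -1)))
      ((NatTrans.isIso_app_iff_of_iso α ((shiftFunctorAdd T n 1).app Δ.obj₁)).1 (h₁ (n + 1)))

instance {G G' : T ⥤ A} (α : G ⟶ G') (J : Type*) [Category* J] [PreservesColimitsOfShape J G]
    [PreservesColimitsOfShape J G'] : (isoLocus α).IsClosedUnderColimitsOfShape J where
  colimitsOfShape_le X := fun ⟨⟨R, π, hR⟩, h⟩ n => by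
    have : IsIso (Functor.whiskerLeft (R ⋙ shiftFunctor T n) α) :=
      have (j : J) : IsIso ((Functor.whiskerLeft (R ⋙ shiftFunctor T n) α).app j) := h j n
      NatIso.isIso_of_isIso_app _
    exact isIso_app_coconePt_of_preservesColimit (R ⋙ shiftFunctor T n) α _
      (isColimitOfPreserves (shiftFunctor T n) hR)

end Homological

section Extension

variable {T : Type u₁} [Category.{v} T] [Preadditive T] [HasZeroObject T] [HasShift T ℤ]
  [∀ n : ℤ, (shiftFunctor T n).Additive] [Pretriangulated T]
  {K : Type u₂} [Category.{v} K] [Preadditive K] [HasZeroObject K] [HasShift K ℤ]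
  [∀ n : ℤ, (shiftFunctor K n).Additive] [Pretriangulated K]
  (F : T ⥤ K) [F.CommShift ℤ] [F.IsTriangulated]
  (hF : ∀ x, isCompact T x → isCompact K (F.obj x))
  [∀ ι : Type v, PreservesColimitsOfShape (Discrete ι) F]
  [HasCoproducts.{v} T] [EssentiallySmall.{v} (Compacts T)]

/-- The extension of an exact functor is exact. -/
instance preservesFiniteLimits_extension : PreservesFiniteLimits (extension F hF) := by
  refine (isProjectiveGenerating_yonedaOnCoproducts (T := T)).preservesFiniteLimits ?_
  intro P₁ P₀ f
  obtain ⟨W, i, δ, hΔ⟩ := distinguished_cocone_triangle₁ f.hom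
  obtain ⟨P₂, h₂, π, hπ⟩ := exists_epi_restrictedYoneda ((restrictedYoneda T).obj W)
  obtain ⟨u, rfl⟩ := (restrictedYoneda_map_bijective_of_coproductOfCompacts h₂ W).2 π
  have hFu : Epi ((restrictedYoneda K).map (F.map u)) := by
    rw [epi_iff_surjective_evalHom] at hπ ⊢
    exact fun c => exists_lift_of_fiber F hΔ P₁.property P₀.property u
      (fun x hx => hπ ⟨x, hx⟩) c.property
  obtain ⟨w, hw⟩ := exact_of_epi_comp ((restrictedYoneda T).map u) _
    ((restrictedYoneda T).map_distinguished_exact _ hΔ)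
    (((restrictedYoneda T).map_comp u i).symm)
  obtain ⟨w', hw'⟩ := exact_of_epi_comp ((restrictedYoneda K).map (F.map u)) _
    ((F ⋙ restrictedYoneda K).map_distinguished_exact _ hΔ)
    (((F ⋙ restrictedYoneda K).map_comp u i).symm)
  let α := extensionComparison F hF
  have h₂' : IsIso (α.app P₂) := isIso_extensionComparison_app F hF h₂
  have h₁' : IsIso (α.app P₁.obj) := isIso_extensionComparison_app F hF P₁.property
  have h₀' : IsIso (α.app P₀.obj) := isIso_extensionComparison_app F hF P₀.property
  refine ⟨⟨P₂, h₂⟩, (restrictedYoneda T).map (u ≫ i), w,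
    ((extension F hF).map_comp _ _).symm.trans
      ((congrArg _ w).trans ((extension F hF).map_zero _ _)), hw, ?_⟩
  let e₂ := asIso (α.app P₂)
  let e₁ := asIso (α.app P₁.obj)
  let e₀ := asIso (α.app P₀.obj)
  exact (ShortComplex.exact_iff_of_iso (ShortComplex.isoMk e₂ e₁ e₀ (α.naturality (u ≫ i)).symm
      (α.naturality f.hom).symm)).2 hw'

instance isHomological_restrictedYoneda_comp_extension :
    (restrictedYoneda T ⋙ extension F hF).IsHomological where
  exact Δ hΔ := ((restrictedYoneda T).map_distinguished_exact Δ hΔ).map (extension F hF)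

/-- The extension agrees with `F` on all of `T`: it does so on compact objects, and the objects on
which it does so form a localizing subcategory. -/
lemma isIso_extensionComparison (hT : ∀ P : ObjectProperty T, P.IsTriangulated →
    (∀ ι : Type v, P.IsClosedUnderColimitsOfShape (Discrete ι)) → isCompact T ≤ P → ∀ X, P X) :
    IsIso (extensionComparison F hF) := by
  have (X : T) : IsIso ((extensionComparison F hF).app X) := by
    have h : isoLocus (extensionComparison F hF) X := by
      refine hT _ inferInstance (fun ι => inferInstance) (fun x hx n => ?_) X
      exact isIso_extensionComparison_app F hF (coproductOfCompacts_of_isCompact (isCompact_shift hx n))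
    exact (NatTrans.isIso_app_iff_of_iso _ ((shiftFunctorZero T ℤ).app X)).1 (h 0)
  exact NatIso.isIso_of_isIso_app _

include hF in
lemma nonempty_mainDiagram (hT : ∀ P : ObjectProperty T, P.IsTriangulated →
    (∀ ι : Type v, P.IsClosedUnderColimitsOfShape (Discrete ι)) → isCompact T ≤ P → ∀ X, P X) :
    Nonempty (MainDiagram F) := by
  have := isIso_extensionComparison F hF hT
  have h : (isoMod (extension F hF).kernel).IsInvertedBy (extension F hF) :=
    ((extension F hF).kernel.isoModSerre_isInvertedBy_iff (extension F hF)).2 le_rfl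
  exact ⟨{
    Fhat := extension F hF
    cocontinuous := inferInstance
    yonedaIso := asIso (extensionComparison F hF)
    Fbar := Localization.Construction.lift _ h
    fac := eqToIso (Localization.Construction.fac _ h) }⟩

end Extension

/-! ### The Gabriel quotient and the kernel -/

open Pretriangulated

section GabrielQuotients

variable {A : Type*} [Category* A] [Abelian A] {E : Type*} [Category* E] [Abelian E]

instance (P : ObjectProperty A) [P.IsSerreClass] : Preadditive (GabrielQuotient P) :=
  inferInstanceAs (Preadditive P.isoModSerre.Localization)

instance (P : ObjectProperty A) [P.IsSerreClass] : (gabrielQ P).Additive :=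
  inferInstanceAs P.isoModSerre.Q.Additive

instance isLocalization_gabrielQ (P : ObjectProperty A) [P.IsSerreClass] :
    (gabrielQ P).IsLocalization P.isoModSerre :=
  inferInstanceAs (P.isoModSerre.Q.IsLocalization P.isoModSerre)

instance abelianGabrielQuotient (P : ObjectProperty A) [P.IsSerreClass] :
    Abelian (GabrielQuotient P) :=
  ObjectProperty.SerreClassLocalization.abelian (gabrielQ P) P

variable {G : A ⥤ E} [PreservesFiniteLimits G] [PreservesFiniteColimits G]
  {Gbar : GabrielQuotient G.kernel ⥤ E} (fac : gabrielQ G.kernel ⋙ Gbar ≅ G)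

include fac

lemma preservesFiniteLimits_of_fac : PreservesFiniteLimits Gbar :=
  (ObjectProperty.SerreClassLocalization.preservesFiniteLimits_comp_iff (gabrielQ G.kernel)
    G.kernel _).1 (preservesFiniteLimits_of_natIso fac.symm)

lemma preservesFiniteColimits_of_fac : PreservesFiniteColimits Gbar :=
  (ObjectProperty.SerreClassLocalization.preservesFiniteColimits_comp_iff (gabrielQ G.kernel)
    G.kernel _).1 (preservesFiniteColimits_of_natIso fac.symm)

lemma isZero_of_fac {X : GabrielQuotient G.kernel} (hX : IsZero (Gbar.obj X)) : IsZero X := by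
  have := Localization.essSurj (gabrielQ G.kernel) G.kernel.isoModSerre
  let e := (gabrielQ G.kernel).objObjPreimageIso X
  refine ((ObjectProperty.SerreClassLocalization.isZero_obj_iff (gabrielQ G.kernel)
    G.kernel _).2 ?_).of_iso e.symm
  exact (hX.of_iso (Gbar.mapIso e)).of_iso (fac.symm.app _)

/-- The functor induced on the Gabriel quotient by the kernel of an exact functor is faithful: it
is exact and kills no nonzero object, in particular no nonzero image. -/
lemma faithful_of_fac : Gbar.Faithful := by
  have := preservesFiniteLimits_of_fac fac
  have := preservesFiniteColimits_of_fac fac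
  have := additive_of_preservesFiniteColimits Gbar
  refine ⟨fun {X Y f g} hfg => ?_⟩
  rw [← sub_eq_zero]
  have h : Gbar.map (Abelian.factorThruImage (f - g)) ≫ Gbar.map (Abelian.image.ι (f - g)) = 0 := by
    rw [← Gbar.map_comp, Abelian.image.fac, Gbar.map_sub, hfg, sub_self]
  have h' : Gbar.map (Abelian.image.ι (f - g)) = 0 := by
    rw [← cancel_epi (Gbar.map (Abelian.factorThruImage (f - g))), h, comp_zero]
  have hI := isZero_of_fac fac (IsZero.of_mono_eq_zero _ h')
  rw [← Abelian.image.fac (f - g), hI.eq_of_src (Abelian.image.ι (f - g)) 0, comp_zero]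

/-- The adjunction induced on the Gabriel quotient by the kernel of a left adjoint. -/
def adjunctionOfFac {U : E ⥤ A} (adj : G ⊣ U) : Gbar ⊣ U ⋙ gabrielQ G.kernel :=
  letI : CatCommSq G (gabrielQ G.kernel) (𝟭 E) Gbar := ⟨G.rightUnitor ≪≫ fac.symm⟩
  letI : CatCommSq U (𝟭 E) (gabrielQ G.kernel) (U ⋙ gabrielQ G.kernel) :=
    ⟨(Functor.leftUnitor _).symm⟩
  adj.localization (gabrielQ G.kernel) (isoMod G.kernel) (𝟭 E) (MorphismProperty.isomorphisms E)
    Gbar (U ⋙ gabrielQ G.kernel)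

omit [Abelian E] [PreservesFiniteLimits G] [PreservesFiniteColimits G] in
lemma adjunctionOfFac_unit_app {U : E ⥤ A} (adj : G ⊣ U) (X : A) :
    (adjunctionOfFac fac adj).unit.app ((gabrielQ G.kernel).obj X) =
      (gabrielQ G.kernel).map (adj.unit.app X ≫ U.map (fac.inv.app X)) := by
  let _ : CatCommSq G (gabrielQ G.kernel) (𝟭 E) Gbar := ⟨G.rightUnitor ≪≫ fac.symm⟩
  let _ : CatCommSq U (𝟭 E) (gabrielQ G.kernel) (U ⋙ gabrielQ G.kernel) :=
    ⟨(Functor.leftUnitor _).symm⟩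
  have := adj.localization_unit_app (gabrielQ G.kernel) (isoMod G.kernel) (𝟭 E)
    (MorphismProperty.isomorphisms E) Gbar (U ⋙ gabrielQ G.kernel) X
  refine this.trans ?_
  rw [Functor.map_comp]
  congr 1
  refine (id_comp _).trans ?_
  change (gabrielQ G.kernel).map (U.map (𝟙 _ ≫ fac.inv.app X)) = _
  rw [id_comp]

omit [Abelian E] [PreservesFiniteLimits G] [PreservesFiniteColimits G] in
/-- The mate of a square into the Gabriel quotient is the image of the mate of the square
before passing to the quotient. -/
lemma mate_adjunctionOfFac {U : E ⥤ A} (adj : G ⊣ U) {C D : Type*} [Category* C] [Category* D]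
    {F : C ⥤ D} {V : D ⥤ C} (adj' : F ⊣ V) {L : C ⥤ A} {R : D ⥤ E} (θ : L ⋙ G ≅ F ⋙ R) (Y : D) :
    mate adj' (adjunctionOfFac fac adj) (L := L ⋙ gabrielQ G.kernel) (R := R)
      (Functor.isoWhiskerLeft L fac ≪≫ θ) Y =
      (gabrielQ G.kernel).map (mate adj' adj θ Y) := by
  rw [mate, mate, Adjunction.homEquiv_unit, Adjunction.homEquiv_unit]
  have := adjunctionOfFac_unit_app fac adj (L.obj (V.obj Y))
  refine (congrArg (· ≫ (U ⋙ gabrielQ G.kernel).map (((Functor.isoWhiskerLeft L fac ≪≫ θ).hom.app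
    (V.obj Y)) ≫ R.map (adj'.counit.app Y))) this).trans ?_
  change (gabrielQ G.kernel).map (adj.unit.app (L.obj (V.obj Y)) ≫ U.map (fac.inv.app
    (L.obj (V.obj Y)))) ≫ (gabrielQ G.kernel).map (U.map ((fac.hom.app (L.obj (V.obj Y)) ≫
      θ.hom.app (V.obj Y)) ≫ R.map (adj'.counit.app Y))) = _
  rw [← Functor.map_comp, assoc, ← U.map_comp, assoc, Iso.inv_hom_id_app_assoc]

end GabrielQuotients

section Diagram

variable {T : Type u₁} [Category.{v} T] [Preadditive T] [HasZeroObject T] [HasShift T ℤ]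
  [∀ n : ℤ, (shiftFunctor T n).Additive] [Pretriangulated T]
  {K : Type u₂} [Category.{v} K] [Preadditive K] [HasZeroObject K] [HasShift K ℤ]
  [∀ n : ℤ, (shiftFunctor K n).Additive] [Pretriangulated K]
  {F : T ⥤ K} [F.CommShift ℤ] [F.IsTriangulated]
  (hF : ∀ x, isCompact T x → isCompact K (F.obj x))
  [∀ ι : Type v, PreservesColimitsOfShape (Discrete ι) F]
  [HasCoproducts.{v} T] [EssentiallySmall.{v} (Compacts T)]

namespace MainDiagram

variable (d : MainDiagram F)

instance : PreservesColimitsOfSize.{v, v} d.Fhat := d.cocontinuous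

instance : PreservesFiniteColimits d.Fhat := PreservesColimitsOfSize.preservesFiniteColimits _

/-- A cocontinuous functor on `Mod-T^c` is determined by its restriction along `h` to coproducts
of compact objects; hence `F̂` is the left adjoint of the restriction along `F`. -/
lemma nonempty_fhatIso : Nonempty (d.Fhat ≅ extension F hF) := by
  have (X : (coproductOfCompacts T).FullSubcategory) :
      IsIso ((Functor.whiskerLeft (coproductOfCompacts T).ι (extensionComparison F hF)).app X) :=
    isIso_extensionComparison_app F hF X.property
  have : IsIso (Functor.whiskerLeft (coproductOfCompacts T).ι (extensionComparison F hF)) :=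
    NatIso.isIso_of_isIso_app _
  let σ : yonedaOnCoproducts T ⋙ d.Fhat ≅ yonedaOnCoproducts T ⋙ extension F hF :=
    Functor.isoWhiskerLeft (coproductOfCompacts T).ι d.yonedaIso ≪≫
      (asIso (Functor.whiskerLeft (coproductOfCompacts T).ι (extensionComparison F hF))).symm
  obtain ⟨τ, -⟩ := isProjectiveGenerating_yonedaOnCoproducts.exists_natIso σ
  exact ⟨τ⟩

include hF in
lemma preservesFiniteLimits_fhat : PreservesFiniteLimits d.Fhat :=
  preservesFiniteLimits_of_natIso (d.nonempty_fhatIso hF).some.symm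

/-- The adjunction between `F̂` and the restriction along `F`. -/
def fhatAdjunction : d.Fhat ⊣ restriction F hF :=
  (extensionAdjunction F hF).ofNatIsoLeft (d.nonempty_fhatIso hF).some.symm

omit [HasZeroObject T] [HasShift T ℤ] [∀ n : ℤ, (shiftFunctor T n).Additive] [Pretriangulated T]
  [HasZeroObject K] [HasShift K ℤ] [∀ n : ℤ, (shiftFunctor K n).Additive] [Pretriangulated K]
  [F.CommShift ℤ] [F.IsTriangulated] [∀ ι : Type v, PreservesColimitsOfShape (Discrete ι) F]
  [HasCoproducts.{v} T] [EssentiallySmall.{v} (Compacts T)] in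
include d in
/-- As `F̂` preserves epimorphisms, `F` preserves the morphisms sent to epimorphisms by `h`. -/
lemma epi_map_obj {X Y : T} (u : X ⟶ Y) [Epi ((restrictedYoneda T).map u)] :
    Epi ((restrictedYoneda K).map (F.map u)) := by
  have h : (restrictedYoneda K).map (F.map u) = d.yonedaIso.inv.app X ≫
      d.Fhat.map ((restrictedYoneda T).map u) ≫ d.yonedaIso.hom.app Y := by
    rw [← cancel_epi (d.yonedaIso.hom.app X), Iso.hom_inv_id_app_assoc]
    exact (d.yonedaIso.hom.naturality u).symm
  rw [h]
  infer_instance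

omit [HasZeroObject T] [HasShift T ℤ] [∀ n : ℤ, (shiftFunctor T n).Additive] [Pretriangulated T]
  [HasZeroObject K] [HasShift K ℤ] [∀ n : ℤ, (shiftFunctor K n).Additive] [Pretriangulated K]
  [F.CommShift ℤ] [F.IsTriangulated] [∀ ι : Type v, PreservesColimitsOfShape (Discrete ι) F]
  [HasCoproducts.{v} T] [EssentiallySmall.{v} (Compacts T)] in
/-- If `F w` is a split epimorphism between images of compact objects, then the cokernel of `h w`
belongs to `B`. -/
lemma cokernel_mem_B {x y : Compacts T} (w : y.obj ⟶ x.obj) [IsSplitEpi (F.map w)] :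
    d.B (cokernel ((restrictedYoneda T).map w)) := by
  refine ⟨?_, isFinitelyPresentable_cokernel (M := rep y) (N := rep x) _⟩
  have h : d.Fhat.map ((restrictedYoneda T).map w) = d.yonedaIso.hom.app _ ≫
      (restrictedYoneda K).map (F.map w) ≫ d.yonedaIso.inv.app _ := by
    have h' : d.Fhat.map ((restrictedYoneda T).map w) ≫ d.yonedaIso.hom.app x.obj =
      d.yonedaIso.hom.app y.obj ≫ (restrictedYoneda K).map (F.map w) := d.yonedaIso.hom.naturality w
    rw [← reassoc_of% h']
    exact ((congrArg _ (d.yonedaIso.hom_inv_id_app x.obj)).trans (comp_id _)).symm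
  have : Epi (d.Fhat.map ((restrictedYoneda T).map w)) := by
    rw [h]
    infer_instance
  have := additive_of_preservesFiniteColimits d.Fhat
  refine IsZero.of_epi_eq_zero (d.Fhat.map (cokernel.π ((restrictedYoneda T).map w))) ?_
  rw [← cancel_epi (d.Fhat.map ((restrictedYoneda T).map w)), ← d.Fhat.map_comp,
    cokernel.condition, d.Fhat.map_zero, comp_zero]

include hF in
/-- A morphism from a representable functor to an object of the kernel of `F̂` factors through a
finitely presented object of the kernel: it lifts to a morphism from the compact object `x` to a
coproduct of compact objects, and its obstruction `x ⟶ Z` to vanish in `Mod-T^c` is killed by `F`,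
so that some `y ⟶ x` killing the morphism becomes a split epimorphism after applying `F`. -/
lemma exists_factorization_of_kernel {M : ModCompacts T} (hM : d.Fhat.kernel M) {x : Compacts T}
    (m : rep x ⟶ M) : ∃ (N : ModCompacts T) (_ : d.B N) (a : rep x ⟶ N) (b : N ⟶ M), a ≫ b = m := by
  have := additive_of_preservesFiniteColimits d.Fhat
  obtain ⟨P₀, P₁, f, π, w, hπ, hw⟩ :=
    (isProjectiveGenerating_yonedaOnCoproducts (T := T)).exists_presentation M
  -- `m` lifts to `x ⟶ P₀`, and `Z` is the cone of `P₁ ⟶ P₀`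
  obtain ⟨Z, j, δ, hΔ⟩ := distinguished_cocone_triangle f.hom
  obtain ⟨a, ha⟩ := (restrictedYoneda_map_bijective x.property P₀.obj).2
    (Projective.factorThru m π)
  have ham : (restrictedYoneda T).map a ≫ π = m := by rw [ha, Projective.factorThru_comp]
  -- `x ⟶ P₀ ⟶ Z` is killed by `F` since `P₀ ⟶ Z` factors through `M` in `Mod-T^c`
  have hfj : f.hom ≫ j = 0 := comp_distTriang_mor_zero₁₂ _ hΔ
  have haj : F.map (a ≫ j) = 0 := by
    have : Epi (ShortComplex.mk _ _ w).g := hπ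
    obtain ⟨μ, hμ⟩ : ∃ μ : M ⟶ (restrictedYoneda T).obj Z, π ≫ μ = (restrictedYoneda T).map j :=
      hw.desc' ((restrictedYoneda T).map j) (((restrictedYoneda T).map_comp _ _).symm.trans
        ((congrArg _ hfj).trans ((restrictedYoneda T).map_zero _ _)))
    have h₁ : (restrictedYoneda T).map (a ≫ j) = m ≫ μ := by
      rw [Functor.map_comp, ← hμ, ← assoc, ham]
    have h₂ : d.Fhat.map ((restrictedYoneda T).map (a ≫ j)) = 0 := by
      rw [h₁, d.Fhat.map_comp]
      exact (congrArg (· ≫ d.Fhat.map μ) (hM.eq_of_tgt _ 0)).trans zero_comp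
    have h₃ : d.Fhat.map ((restrictedYoneda T).map (a ≫ j)) ≫ d.yonedaIso.hom.app Z =
        d.yonedaIso.hom.app x.obj ≫ (restrictedYoneda K).map (F.map (a ≫ j)) :=
      d.yonedaIso.hom.naturality (a ≫ j)
    apply (restrictedYoneda_map_bijective (hF _ x.property) (F.obj Z)).1
    rw [Functor.map_zero, ← cancel_epi (d.yonedaIso.hom.app x.obj), ← h₃, h₂]
    exact zero_comp.trans comp_zero.symm
  obtain ⟨V, b, δ', hΔ'⟩ := distinguished_cocone_triangle₁ (a ≫ j)
  obtain ⟨s, hs⟩ : ∃ s : F.obj x.obj ⟶ F.obj V, 𝟙 (F.obj x.obj) = s ≫ F.map b :=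
    Triangle.coyoneda_exact₂ _ (F.map_distinguished _ hΔ') (𝟙 (F.obj x.obj))
      ((congrArg _ haj).trans comp_zero)
  obtain ⟨P, hP, κ, hκ⟩ := exists_epi_restrictedYoneda ((restrictedYoneda T).obj V)
  obtain ⟨u, rfl⟩ := (restrictedYoneda_map_bijective_of_coproductOfCompacts hP V).2 κ
  -- the section `s` factors through `F y` for some compact object `y` over `V`
  obtain ⟨s', hs'⟩ : ∃ s' : F.obj x.obj ⟶ F.obj P, s' ≫ F.map u = s :=
    (epi_iff_surjective_evalHom _).1 (d.epi_map_obj u) ⟨_, hF _ x.property⟩ s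
  obtain ⟨y, r, t, hrt⟩ := exists_factorization F hP (hF _ x.property) s'
  have : IsSplitEpi (F.map (t ≫ u ≫ b)) := ⟨⟨⟨s' ≫ F.map r, by
    rw [F.map_comp, F.map_comp, assoc, reassoc_of% hrt, reassoc_of% hs', hs]⟩⟩⟩
  refine ⟨_, d.cokernel_mem_B (t ≫ u ≫ b), cokernel.π _, cokernel.desc _ m ?_, cokernel.π_desc _ _ _⟩
  have hb : b ≫ a ≫ j = 0 := comp_distTriang_mor_zero₁₂ _ hΔ'
  obtain ⟨g, hg⟩ : ∃ g : y.obj ⟶ P₁.obj, (t ≫ u ≫ b) ≫ a = g ≫ f.hom :=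
    Triangle.coyoneda_exact₂ _ hΔ _ (show ((t ≫ u ≫ b) ≫ a) ≫ j = 0 by simp [hb])
  rw [← ham, ← assoc, ← Functor.map_comp, hg, Functor.map_comp, assoc]
  exact (congrArg _ w).trans comp_zero

include hF in
/-- The kernel of `F̂` is generated by its finitely presented objects. -/
lemma kernel_eq_loc : d.Fhat.kernel = loc.{v} d.B := by
  have := d.preservesFiniteLimits_fhat hF
  refine le_antisymm (fun M hM P hP hP' hB => ?_) (fun M hM => hM _ inferInstance ?_ inf_le_left)
  · have : P.IsSerreClass := hP
    obtain ⟨X, hX, π, hπ⟩ := exists_epi_restrictedYoneda M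
    obtain ⟨ι, x, s, ⟨hs⟩⟩ := exists_cofan hX
    choose N hN a b hab using fun i =>
      d.exists_factorization_of_kernel hF hM ((restrictedYoneda T).map (s i) ≫ π)
    obtain ⟨ψ, hψ⟩ := exists_desc_of_cofan hs fun i => a i ≫ Sigma.ι N i
    have h : ψ ≫ Sigma.desc b = π := hom_ext_of_cofan hs fun i => by
      rw [reassoc_of% (hψ i), Sigma.ι_desc, hab]
    have := hP' ι
    have : Epi (ψ ≫ Sigma.desc b) := h ▸ hπ
    have : Epi (Sigma.desc b) := epi_of_epi ψ _
    exact P.prop_of_epi (Sigma.desc b) (P.prop_colimit _ fun i => hB _ (hN i.as))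
  · intro ι
    refine ⟨fun X ⟨⟨R, p, hR⟩, h⟩ => ?_⟩
    refine (IsZero.iff_id_eq_zero (d.Fhat.obj X)).2 ?_
    exact (isColimitOfPreserves d.Fhat hR).hom_ext fun j => (h j).eq_of_src _ _

end MainDiagram

end Diagram

/-! ### The induced comonad -/

section ComonadUniqueness

variable {K : Type u} [Category.{v} K] [Preadditive K] [HasCoproducts.{v} K]
  [EssentiallySmall.{v} (Compacts K)]

/-- If all objects of `K` are coproducts of compact objects, a cocontinuous comonad on `Mod-K^c`
is determined by its restriction along `h`. -/
lemma nonempty_comonadIso (hK : ∀ X, coproductOfCompacts K X) {G : Comonad K}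
    {H H' : Comonad (ModCompacts K)} (hH : PreservesColimitsOfSize.{v, v} H.toFunctor)
    (hH' : PreservesColimitsOfSize.{v, v} H'.toFunctor)
    (e : ComonadExtension (restrictedYoneda K) G H)
    (e' : ComonadExtension (restrictedYoneda K) G H') : Nonempty (H ≅ H') := by
  have : PreservesFiniteColimits H.toFunctor := PreservesColimitsOfSize.preservesFiniteColimits _
  have : PreservesFiniteColimits H'.toFunctor := PreservesColimitsOfSize.preservesFiniteColimits _
  have gen := isProjectiveGenerating_yonedaOnCoproducts (T := K)
  obtain ⟨τ, hτ⟩ := gen.exists_natIso (G := H.toFunctor) (G' := H'.toFunctor)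
    (Functor.isoWhiskerLeft (coproductOfCompacts K).ι (e.iso ≪≫ e'.iso.symm))
  have hτ' (X : K) : τ.hom.app ((restrictedYoneda K).obj X) =
    e.iso.hom.app X ≫ e'.iso.inv.app X := hτ ⟨X, hK X⟩
  have hε : τ.hom ≫ H'.ε = H.ε := gen.natTrans_ext fun X => by
    change τ.hom.app ((restrictedYoneda K).obj X.obj) ≫ H'.ε.app ((restrictedYoneda K).obj X.obj) =
      H.ε.app ((restrictedYoneda K).obj X.obj)
    rw [hτ', ← e.counit, ← e'.counit, assoc, Iso.inv_hom_id_app_assoc]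
  let ττ : H.toFunctor ⋙ H.toFunctor ⟶ H'.toFunctor ⋙ H'.toFunctor :=
    Functor.whiskerLeft H.toFunctor τ.hom ≫ Functor.whiskerRight τ.hom H'.toFunctor
  have hδ : τ.hom ≫ H'.δ = H.δ ≫ ττ := gen.natTrans_ext fun X => by
    change τ.hom.app ((restrictedYoneda K).obj X.obj) ≫ H'.δ.app ((restrictedYoneda K).obj X.obj) =
      H.δ.app ((restrictedYoneda K).obj X.obj) ≫ τ.hom.app (H.obj ((restrictedYoneda K).obj X.obj)) ≫
        H'.map (τ.hom.app ((restrictedYoneda K).obj X.obj))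
    have h₁ : H.map (e.iso.hom.app X.obj) ≫
        τ.hom.app ((restrictedYoneda K).obj (G.obj X.obj)) =
        τ.hom.app (H.obj ((restrictedYoneda K).obj X.obj)) ≫ H'.map (e.iso.hom.app X.obj) :=
      τ.hom.naturality (e.iso.hom.app X.obj)
    have h₂ := e.comul X.obj
    have h₃ : e'.iso.inv.app X.obj ≫ H'.δ.app ((restrictedYoneda K).obj X.obj) =
        (restrictedYoneda K).map (G.δ.app X.obj) ≫ e'.iso.inv.app (G.obj X.obj) ≫
          H'.map (e'.iso.inv.app X.obj) := by
      have h := e'.comul X.obj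
      rw [← cancel_epi (e'.iso.hom.app X.obj), reassoc_of% h, Iso.hom_inv_id_app_assoc,
        Iso.hom_inv_id_app_assoc]
      have h₄ : H'.map (e'.iso.hom.app X.obj) ≫ H'.map (e'.iso.inv.app X.obj) = 𝟙 _ := by
        rw [← Functor.map_comp, Iso.hom_inv_id_app, CategoryTheory.Functor.map_id]
      exact ((congrArg _ h₄).trans (comp_id _)).symm
    rw [hτ', assoc, h₃, reassoc_of% h₂, Functor.map_comp, ← reassoc_of% h₁, hτ', assoc]
  exact ⟨ComonadIso.mk τ (fun X => congr(($hε).app X)) fun X => congr(($hδ).app X)⟩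

end ComonadUniqueness

section Diagram

variable {T : Type u₁} [Category.{v} T] [Preadditive T] [HasZeroObject T] [HasShift T ℤ]
  [∀ n : ℤ, (shiftFunctor T n).Additive] [Pretriangulated T]
  {K : Type u₂} [Category.{v} K] [Preadditive K] [HasZeroObject K] [HasShift K ℤ]
  [∀ n : ℤ, (shiftFunctor K n).Additive] [Pretriangulated K]
  {F : T ⥤ K} [F.CommShift ℤ] [F.IsTriangulated]
  (hF : ∀ x, isCompact T x → isCompact K (F.obj x))
  [∀ ι : Type v, PreservesColimitsOfShape (Discrete ι) F]
  [HasCoproducts.{v} T] [EssentiallySmall.{v} (Compacts T)]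

namespace MainDiagram

variable (d : MainDiagram F)

/-- The morphism `h U Y ⟶ (h Y) ∘ F` adjoint to `F̂ h U Y ≅ h F U Y ⟶ h Y` is invertible: on a
compact object `x` it is the adjunction isomorphism `Hom(x, U Y) ≅ Hom(F x, Y)`. -/
lemma isIso_mate_fhatAdjunction {U : K ⥤ T} (adj : F ⊣ U) (Y : K) :
    IsIso (mate adj (d.fhatAdjunction hF) d.yonedaIso Y) := by
  refine isIso_of_rep _ fun x => ?_
  rw [← Function.Bijective.of_comp_iff _ (restrictedYoneda_map_bijective x.property (U.obj Y))]
  let e₁ := (adj.homEquiv x.obj Y).symm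
  let e₂ := Equiv.ofBijective _ (restrictedYoneda_map_bijective (hF _ x.property) Y)
  let e₃ : ((restrictedYoneda K).obj (F.obj x.obj) ⟶ (restrictedYoneda K).obj Y) ≃
      (d.Fhat.obj (rep x) ⟶ (restrictedYoneda K).obj Y) :=
    (d.yonedaIso.app x.obj).symm.homFromEquiv
  let e₄ := (d.fhatAdjunction hF).homEquiv (rep x) ((restrictedYoneda K).obj Y)
  convert (e₁.trans (e₂.trans (e₃.trans e₄))).bijective using 1
  funext f
  have h₁ : (restrictedYoneda T).map f ≫ mate adj (d.fhatAdjunction hF) d.yonedaIso Y =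
      e₄ (d.Fhat.map ((restrictedYoneda T).map f) ≫
        (d.yonedaIso.hom.app (U.obj Y) ≫ (restrictedYoneda K).map (adj.counit.app Y))) :=
    ((d.fhatAdjunction hF).homEquiv_naturality_left _ _).symm
  have h₂ : d.Fhat.map ((restrictedYoneda T).map f) ≫ d.yonedaIso.hom.app (U.obj Y) =
      d.yonedaIso.hom.app x.obj ≫ (restrictedYoneda K).map (F.map f) := d.yonedaIso.hom.naturality f
  have h₃ : e₁ f = F.map f ≫ adj.counit.app Y := adj.homEquiv_counit x.obj Y f
  refine h₁.trans (congrArg e₄ ?_)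
  change _ = d.yonedaIso.hom.app x.obj ≫ (restrictedYoneda K).map (e₁ f)
  rw [reassoc_of% h₂, h₃]
  exact congrArg _ ((restrictedYoneda K).map_comp _ _).symm

variable {Ubar : ModCompacts K ⥤ d.AB} (adjbar : d.Fbar ⊣ Ubar)

include hF in
/-- `F̄` is faithful and exact, hence comonadic. -/
lemma isEquivalence_comparison : (Comonad.comparison adjbar).IsEquivalence := by
  have := d.preservesFiniteLimits_fhat hF
  have := preservesFiniteLimits_of_fac d.fac
  have := faithful_of_fac d.fac
  exact comparison_isEquivalence adjbar

include hF in
lemma isInducedComonad {U : K ⥤ T} (adj : F ⊣ U) :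
    IsInducedComonad adj.toComonad adjbar.toComonad where
  cocontinuous := by
    have := d.preservesFiniteLimits_fhat hF
    let i : Ubar ⋙ d.Fbar ≅ restriction F hF ⋙ d.Fhat :=
      Functor.isoWhiskerRight (adjbar.rightAdjointUniq
        (adjunctionOfFac d.fac (d.fhatAdjunction hF))) d.Fbar ≪≫
        Functor.isoWhiskerLeft (restriction F hF) d.fac
    have := comp_preservesColimits.{v, v} (restriction F hF) d.Fhat
    exact preservesColimits_of_natIso i.symm
  extension := by
    have := d.preservesFiniteLimits_fhat hF
    let θ : (restrictedYoneda T ⋙ gabrielQ d.Fhat.kernel) ⋙ d.Fbar ≅ F ⋙ restrictedYoneda K :=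
      Functor.isoWhiskerLeft (restrictedYoneda T) d.fac ≪≫ d.yonedaIso
    have (Y : K) : IsIso (mate adj adjbar θ Y) := by
      have : IsIso (mate adj (adjunctionOfFac d.fac (d.fhatAdjunction hF)) θ Y) := by
        rw [mate_adjunctionOfFac]
        have := d.isIso_mate_fhatAdjunction hF adj Y
        infer_instance
      exact isIso_mate_of_isIso_mate adj (adjunctionOfFac d.fac (d.fhatAdjunction hF)) θ adjbar Y
    exact ⟨comonadExtensionOfIsIsoMate adj adjbar θ⟩

end MainDiagram

end Diagram

end

end HomologicalResidue

open HomologicalResidue in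
theorem theorem4p2
    {T : Type u₁} [Category.{v} T] [Preadditive T] [HasZeroObject T] [HasShift T ℤ]
    [∀ n : ℤ, (shiftFunctor T n).Additive] [Pretriangulated T] [IsTriangulated T]
    [MonoidalCategory T] [SymmetricCategory T]
    {K : Type u₂} [Category.{v} K] [Preadditive K] [HasZeroObject K] [HasShift K ℤ]
    [∀ n : ℤ, (shiftFunctor K n).Additive] [Pretriangulated K] [IsTriangulated K]
    [MonoidalCategory K] [SymmetricCategory K]
    (hT : IsBigTTCategory T) (hK : IsTTField K)
    (F : T ⥤ K) [F.Monoidal] [F.CommShift ℤ] [F.IsTriangulated]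
    (U : K ⥤ T) (adj : F ⊣ U) :
    Nonempty (MainDiagram F) ∧
    ∀ d : MainDiagram F,
      PreservesFiniteLimits d.Fhat ∧
      d.Fhat.kernel = loc.{v} d.B ∧
      Nonempty (Abelian d.AB) ∧
      PreservesFiniteLimits d.Fbar ∧ PreservesFiniteColimits d.Fbar ∧ d.Fbar.Faithful ∧
      Nonempty (ComonadicLeftAdjoint d.Fbar) ∧
      ∀ (Ubar : ModCompacts K ⥤ d.AB) (adjbar : d.Fbar ⊣ Ubar),
        (Comonad.comparison adjbar).IsEquivalence ∧
        IsInducedComonad adj.toComonad adjbar.toComonad ∧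
        ∀ H : Comonad (ModCompacts K), IsInducedComonad adj.toComonad H →
          Nonempty (adjbar.toComonad ≅ H) ∧
          ∃ E : d.AB ≌ H.Coalgebra, Nonempty (E.functor ⋙ H.forget ≅ d.Fbar) := by
  have := hT.hasCoproducts
  have := hT.essentiallySmall
  have := hK.hasCoproducts
  have := hK.essentiallySmall
  have (ι : Type v) : PreservesColimitsOfShape (Discrete ι) F :=
    adj.leftAdjoint_preservesColimits.{v, v}.preservesColimitsOfShape
  have hF (x : T) (hx : isCompact T x) : isCompact K (F.obj x) :=
    (hK.compact_iff_rigid _).2 (isRigid_obj F ((hT.compact_iff_rigid x).1 hx))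
  refine ⟨nonempty_mainDiagram F hF hT.generates, fun d => ?_⟩
  have := d.preservesFiniteLimits_fhat hF
  refine ⟨this, d.kernel_eq_loc hF, ⟨abelianGabrielQuotient _⟩, preservesFiniteLimits_of_fac d.fac,
    preservesFiniteColimits_of_fac d.fac, faithful_of_fac d.fac,
    ⟨{  R := _
        adj := adjunctionOfFac d.fac (d.fhatAdjunction hF)
        eqv := d.isEquivalence_comparison hF _ }⟩, fun Ubar adjbar => ?_⟩
  have := d.isEquivalence_comparison hF adjbar
  have hd := d.isInducedComonad hF adjbar adj
  refine ⟨this, hd, fun H hH => ?_⟩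
  obtain ⟨i⟩ := nonempty_comonadIso hK.coproduct_of_compacts hd.cocontinuous hH.cocontinuous
    hd.extension.some hH.extension.some
  exact ⟨⟨i⟩, exists_equivalence_coalgebra adjbar i⟩
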